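/- Let $X$ be a poset, regarded as a category with a unique morphism $x\to y$ whenever $x\le y$, and let $\mathcal F\colon X\to\mathcal{A}b$ be a covariant functor to the category of abelian groups. For $n\ge 0$ let $\mathrm{Ch}_n(X)$ be the set of $n$-chains $s=\{x_0<x_1<\dots<x_n\}$ of $X$. The homology groups $H_n(X;\mathcal F)$, $n\in\mathbb Z$, are those of the chain complex $C(X;\mathcal F)$ with $C_n(X;\mathcal F)=\bigoplus_{s\in \mathrm{Ch}_n(X)}\mathcal F(\min s)$ for $n\ge 0$, $C_n(X;\mathcal F)=0$ for $n<0$, whose differential maps $a$ in the summand $\mathcal F(\min s)$ indexed by $s=\{x_0<\dots<x_n\}$, $n\ge 1$, to $\sum_{i=0}^n(-1)^i\,\mathcal F(\min s\le\min (s\setminus\{x_i\}))(a)$, the $i$-th term lying in the summand indexed by $s\setminus\{x_i\}$. Let $L$ be a finite boolean lattice with maximum $1_L$. For $x\in L$ let $\mathrm{rk}(x)$ be one less than the maximum cardinality of a chain in $\{y\in L : y\le x\}$, and let $r=\mathrm{rk}(1_L)$. Fix an isomorphism of posets $\phi=(\phi_1,\dots,\phi_r)\colon L\to\{0,1\}^r$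 (equivalently, a total ordering of the atoms of $L$). If $y$ covers $x$ in $L$ (written $x\prec y$), let $m_{xy}$ be the unique index with $\phi_{m_{xy}}(x)=0$, $\phi_{m_{xy}}(y)=1$ and $\phi_j(x)=\phi_j(y)$ for all $j\ne m_{xy}$, and let $\varepsilon(x\prec y)=\prod_{j=1}^{m_{xy}}(-1)^{\phi_j(x)}$. Let $\mathcal F\colon L\setminus\{1_L\}\to\mathcal{A}b$ be a covariant functor. For $n\in\mathbb Z$ let $D_n=\{x\in L\setminus\{1_L\} : \mathrm{rk}(x)=r-n-1\}$, and let $\mathcal C=(C_n,d_n)_{n\in\mathbb Z}$ be the chain complex with $C_n=\bigoplus_{x\in D_n}\mathcal F(x)$ and differentials $d_n\colon C_n\to C_{n-1}$ given by $d_n(\lambda)=\sum\varepsilon(x\prec y)\,\mathcal F(x\le y)(\lambda)$ for $\lambda\in\mathcal F(x)$, $x\in D_n$, where the sum is over the elements $y\in L\setminus\{1_L\}$ which cover $x$. Then $$H_n(L\setminus\{1_L\};\mathcal F)\cong H_n(\mathcal C)\qquad\text{for all } n\in\mathbb Z.$$ -/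

import Mathlib

open CategoryTheory

open scoped DirectSum

universe u v

namespace PosetHomology

section OrderComplex

/-- An `n`-chain of the poset `X`: a chain of cardinality `n + 1`, listed increasingly as
`x₀ < x₁ < ⋯ < xₙ`. -/
def Chains (X : Type u) [PartialOrder X] (n : ℕ) : Type u :=
  {s : Fin (n + 1) → X // StrictMono s}

variable {X : Type u} [PartialOrder X]

/-- The least element of a chain. -/
def Chains.min {n : ℕ} (s : Chains X n) : X := s.1 0

/-- The chain obtained by omitting the `i`-th element. -/
def Chains.face {n : ℕ} (s : Chains X (n + 1)) (i : Fin (n + 2)) : Chains X n :=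
  ⟨fun j => s.1 (i.succAbove j), fun _ _ h => s.2 (Fin.strictMono_succAbove i h)⟩

theorem Chains.min_le_min_face {n : ℕ} (s : Chains X (n + 1)) (i : Fin (n + 2)) :
    s.min ≤ (s.face i).min :=
  s.2.monotone (Fin.zero_le _)

theorem Chains.face_face {n : ℕ} (s : Chains X (n + 2)) (i : Fin (n + 3)) (j : Fin (n + 2)) :
    (s.face (i.succAbove j)).face (j.predAbove i) = (s.face i).face j := by
  apply Subtype.ext
  funext k
  exact congrArg s.1 (Fin.succAbove_succAbove_succAbove_predAbove i j k)

variable (F : X ⥤ AddCommGrpCat.{v})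

open Classical in
/-- The boundary `Cₙ₊₁(X; F) → Cₙ(X; F)`: on the summand `F (min s)` of `s = {x₀ < ⋯ < xₙ₊₁}` it is
`∑ᵢ (-1)ⁱ F (min s ≤ min (s \ {xᵢ}))`, the `i`-th term landing in the summand of `s \ {xᵢ}`. -/
noncomputable def chainBoundary (n : ℕ) :
    (⨁ s : Chains X (n + 1), F.obj s.min) →+ (⨁ s : Chains X n, F.obj s.min) :=
  DirectSum.toAddMonoid fun s => ∑ i : Fin (n + 2), (-1 : ℤ) ^ (i : ℕ) •
    (DirectSum.of (fun t : Chains X n => F.obj t.min) (s.face i)).comp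
      (F.map (homOfLE (s.min_le_min_face i))).hom

open Classical in
theorem of_map_congr {ι : Type*} (f : ι → X) {x : X} {s t : ι} (h : s = t)
    (hs : x ⟶ f s) (ht : x ⟶ f t) (a : F.obj x) :
    DirectSum.of (fun i => F.obj (f i)) s ((F.map hs).hom a) =
      DirectSum.of (fun i => F.obj (f i)) t ((F.map ht).hom a) := by
  subst h
  rw [Subsingleton.elim hs ht]

open Classical in
theorem chainBoundary_of (n : ℕ) (s : Chains X (n + 1)) (a : F.obj s.min) :
    chainBoundary F n (DirectSum.of (fun t : Chains X (n + 1) => F.obj t.min) s a) =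
      ∑ i : Fin (n + 2), (-1 : ℤ) ^ (i : ℕ) •
        DirectSum.of (fun t : Chains X n => F.obj t.min) (s.face i)
          ((F.map (homOfLE (s.min_le_min_face i))).hom a) := by
  simp [chainBoundary, DirectSum.toAddMonoid_of, AddMonoidHom.finsetSum_apply]

theorem chainBoundary_comp (n : ℕ) :
    (chainBoundary F n).comp (chainBoundary F (n + 1)) = 0 := by
  classical
  refine DirectSum.addHom_ext fun s a => ?_
  rw [AddMonoidHom.comp_apply, chainBoundary_of, map_sum]
  simp only [map_zsmul, chainBoundary_of, Finset.smul_sum, AddMonoidHom.zero_apply]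
  rw [← Finset.sum_product']
  refine Finset.sum_ninvolution (fun p => (p.1.succAbove p.2, p.2.predAbove p.1)) ?_ ?_ ?_ ?_
  · rintro ⟨i, j⟩
    have key := of_map_congr F Chains.min (s.face_face i j)
      (homOfLE ((s.min_le_min_face _).trans ((s.face _).min_le_min_face _)))
      (homOfLE ((s.min_le_min_face i).trans ((s.face i).min_le_min_face j))) a
    have comp : ∀ (i : Fin (n + 3)) (j : Fin (n + 2)),
        (F.map (homOfLE ((s.face i).min_le_min_face j))).hom
          ((F.map (homOfLE (s.min_le_min_face i))).hom a) =
        (F.map (homOfLE ((s.min_le_min_face i).trans ((s.face i).min_le_min_face j)))).hom a := by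
      intro i j
      rw [← homOfLE_comp (s.min_le_min_face i) ((s.face i).min_le_min_face j), F.map_comp]
      rfl
    simp only [comp, smul_smul, key, ← pow_add]
    rw [Fin.neg_one_pow_succAbove_add_predAbove, ← add_smul]
    simp
  · rintro ⟨i, j⟩ - h
    exact Fin.succAbove_ne i j (congrArg Prod.fst h)
  · simp
  · rintro ⟨i, j⟩
    ext1
    · exact Fin.succAbove_succAbove_predAbove i j
    · exact Fin.predAbove_predAbove_succAbove i j

/-- The complex `C(X; F)` in degrees `n ≥ 0`. -/
noncomputable def orderComplexNat : ChainComplex AddCommGrpCat.{max u v} ℕ :=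
  ChainComplex.of (fun n => AddCommGrpCat.of (⨁ s : Chains X n, F.obj s.min))
    (fun n => AddCommGrpCat.ofHom (chainBoundary F n)) fun n => by
      rw [← AddCommGrpCat.ofHom_comp, chainBoundary_comp]
      rfl

/-- The inclusion of the degrees `n ≥ 0` into all integral degrees. -/
def embeddingNatInt : (ComplexShape.down ℕ).Embedding (ComplexShape.down ℤ) :=
  ComplexShape.Embedding.mk' _ _ (fun n => (n : ℤ)) (fun _ _ h => by simpa using h)
    (by intro i j; simp only [ComplexShape.down_Rel]; omega)

/-- The chain complex `C(X; F)`, with `Cₙ(X; F) = ⨁_{s ∈ Chₙ(X)} F (min s)` for `n ≥ 0` and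
`Cₙ(X; F) = 0` for `n < 0`. -/
noncomputable def orderComplex : ChainComplex AddCommGrpCat.{max u v} ℤ :=
  (orderComplexNat F).extend embeddingNatInt

end OrderComplex

section Cube

variable {L : Type u} [BooleanAlgebra L]

/-- The rank of an element: the height of `{y | y ≤ x}`, i.e. one less than the largest cardinality
of a chain in it. -/
noncomputable def rk (x : L) : ℕ := (Order.height x).toNat

theorem exists_flip {r : ℕ} (φ : L ≃o (Fin r → Bool)) {x y : L} (h : x ⋖ y) :
    ∃ m, φ x m = false ∧ φ y m = true ∧ ∀ j, j ≠ m → φ x j = φ y j := by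
  classical
  have h' : φ x ⋖ φ y := (apply_covBy_apply_iff φ).2 h
  obtain ⟨m, hm⟩ : ∃ m, φ x m < φ y m := (Pi.lt_def.1 h'.lt).2
  have hx : φ x m = false := by revert hm; cases φ x m <;> simp
  have hy : φ y m = true := by revert hm; cases φ y m <;> simp
  refine ⟨m, hx, hy, fun j hj => ?_⟩
  by_contra hne
  have hle : Function.update (φ x) m true ≤ φ y := by
    intro k
    by_cases hk : k = m
    · subst hk; simp [hy]
    · simpa [hk] using h'.le k
  refine h'.2 (c := Function.update (φ x) m true) ?_ (lt_of_le_of_ne hle ?_)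
  · refine Pi.lt_def.2 ⟨fun k => ?_, m, by simp [hx]⟩
    by_cases hk : k = m
    · subst hk; simp
    · simp [hk]
  · intro he
    exact hne (by simpa [hj] using congrFun he j)

/-- The coordinate `m_{xy}` in which the two ends of a cover relation `x ⋖ y` differ. -/
noncomputable def flipIndex {r : ℕ} (φ : L ≃o (Fin r → Bool)) {x y : L} (h : x ⋖ y) : Fin r :=
  (exists_flip φ h).choose

/-- The sign `ε(x ⋖ y) = ∏_{j ≤ m_{xy}} (-1)^{φⱼ(x)}`. -/
noncomputable def coverSign {r : ℕ} (φ : L ≃o (Fin r → Bool)) {x y : L} (h : x ⋖ y) : ℤ :=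
  ∏ j ∈ Finset.Iic (flipIndex φ h), (-1) ^ (φ x j).toNat

variable (L) in
/-- The set `Dₙ` of the elements of `L \ {⊤}` of rank `rk L - n - 1`, where `rk L = rk ⊤`. -/
def Level (n : ℤ) : Type u :=
  {x : {x : L // x ≠ ⊤} // (rk x.1 : ℤ) = (rk (⊤ : L) : ℤ) - n - 1}

instance [Finite L] (n : ℤ) : Finite (Level L n) :=
  inferInstanceAs (Finite {x : {x : L // x ≠ ⊤} // (rk x.1 : ℤ) = (rk (⊤ : L) : ℤ) - n - 1})

noncomputable instance [Finite L] (n : ℤ) : Fintype (Level L n) := Fintype.ofFinite _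

open Classical in
/-- The differential `Cₙ₊₁ → Cₙ` of the cube complex: on the summand `F x` it is
`∑ ε(x ⋖ y) F (x ≤ y)`, summed over the elements `y` covering `x`. -/
noncomputable def cubeBoundary [Finite L] {r : ℕ} (φ : L ≃o (Fin r → Bool))
    (F : {x : L // x ≠ ⊤} ⥤ AddCommGrpCat.{v}) (n : ℤ) :
    (⨁ x : Level L (n + 1), F.obj x.1) →+ (⨁ x : Level L n, F.obj x.1) :=
  DirectSum.toAddMonoid fun x => ∑ y : Level L n,
    if h : x.1.1 ⋖ y.1.1 then
      coverSign φ h • (DirectSum.of (fun y : Level L n => F.obj y.1) y).comp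
        (F.map (homOfLE (show x.1 ≤ y.1 from h.le))).hom
    else 0

theorem flipIndex_spec {r : ℕ} (φ : L ≃o (Fin r → Bool)) {x y : L} (h : x ⋖ y) :
    φ x (flipIndex φ h) = false ∧ φ y = Function.update (φ x) (flipIndex φ h) true := by
  obtain ⟨h1, h2, h3⟩ := (exists_flip φ h).choose_spec
  refine ⟨h1, funext fun j => ?_⟩
  by_cases hj : j = flipIndex φ h
  · subst hj
    rw [Function.update_self]
    exact h2
  · rw [Function.update_of_ne hj]
    exact (h3 j hj).symm

theorem flipIndex_eq {r : ℕ} (φ : L ≃o (Fin r → Bool)) {x y : L} (h : x ⋖ y) {m : Fin r}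
    (hx : φ x m = false) (hy : φ y m = true) : flipIndex φ h = m := by
  obtain ⟨-, h2⟩ := flipIndex_spec φ h
  by_contra hne
  rw [h2, Function.update_of_ne (Ne.symm hne), hx] at hy
  exact Bool.false_ne_true hy

theorem covBy_of_update {r : ℕ} (φ : L ≃o (Fin r → Bool)) {x y : L} {m : Fin r}
    (hx : φ x m = false) (hy : φ y = Function.update (φ x) m true) : x ⋖ y := by
  refine (apply_covBy_apply_iff φ).1 ?_
  rw [hy, Pi.covBy_iff_exists_right_eq]
  exact ⟨m, true, by rw [hx]; decide, rfl⟩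

/-- The sign `∏_{j ≤ m} (-1)^{bⱼ}`. -/
def prefixSign {r : ℕ} (b : Fin r → Bool) (m : Fin r) : ℤ :=
  ∏ j ∈ Finset.Iic m, (-1) ^ (b j).toNat

theorem prefixSign_update_of_le {r : ℕ} (b : Fin r → Bool) {m k : Fin r} (hm : b m = false)
    (h : m ≤ k) : prefixSign (Function.update b m true) k = -prefixSign b k := by
  have hk : m ∈ Finset.Iic k := Finset.mem_Iic.2 h
  rw [prefixSign, prefixSign, ← Finset.mul_prod_erase _ _ hk, ← Finset.mul_prod_erase _ _ hk,
    Finset.prod_congr rfl (g := fun j => (-1 : ℤ) ^ (b j).toNat)]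
  · simp [hm]
  · intro j hj
    rw [Function.update_of_ne (Finset.ne_of_mem_erase hj)]

theorem prefixSign_update_of_lt {r : ℕ} (b : Fin r → Bool) {m k : Fin r} (h : k < m) :
    prefixSign (Function.update b m true) k = prefixSign b k := by
  refine Finset.prod_congr rfl fun j hj => ?_
  rw [Function.update_of_ne ((Finset.mem_Iic.1 hj).trans_lt h).ne]

theorem prefixSign_anticomm {r : ℕ} (b : Fin r → Bool) {m k : Fin r} (hm : b m = false)
    (hk : b k = false) (hne : m ≠ k) :
    prefixSign b m * prefixSign (Function.update b m true) k +
      prefixSign b k * prefixSign (Function.update b k true) m = 0 := by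
  rcases lt_or_gt_of_ne hne with h | h
  · rw [prefixSign_update_of_le b hm h.le, prefixSign_update_of_lt b h]
    ring
  · rw [prefixSign_update_of_le b hk h.le, prefixSign_update_of_lt b h]
    ring

/-- An interval of length two has exactly two intermediate elements, and the signs along the two
maximal chains are opposite. -/
theorem exists_diamond {r : ℕ} (φ : L ≃o (Fin r → Bool)) {x y z : L} (h : x ⋖ y) (h' : y ⋖ z) :
    ∃ (w : L) (k : x ⋖ w) (k' : w ⋖ z), w ≠ y ∧
      coverSign φ h * coverSign φ h' + coverSign φ k * coverSign φ k' = 0 ∧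
      ∀ t, x ⋖ t → t ⋖ z → t = y ∨ t = w := by
  obtain ⟨hx, hy⟩ := flipIndex_spec φ h
  obtain ⟨hy', hz⟩ := flipIndex_spec φ h'
  generalize hm : flipIndex φ h = m at hx hy
  generalize hk : flipIndex φ h' = k at hy' hz
  have hne : m ≠ k := by
    rintro rfl
    simp [hy] at hy'
  have hxk : φ x k = false := by simpa [hy, hne.symm] using hy'
  have hw : φ (φ.symm (Function.update (φ x) k true)) = Function.update (φ x) k true :=
    φ.apply_symm_apply _
  generalize φ.symm (Function.update (φ x) k true) = w at hw
  have hwm : φ w m = false := by simp [hw, hne, hx]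
  have hz' : φ z = Function.update (φ w) m true := by
    rw [hz, hy, hw, Function.update_comm hne.symm]
  have k1 : x ⋖ w := covBy_of_update φ hxk hw
  have k2 : w ⋖ z := covBy_of_update φ hwm hz'
  refine ⟨w, k1, k2, ?_, ?_, ?_⟩
  · rintro rfl
    simp [hy] at hwm
  · have e1 : flipIndex φ k1 = k := flipIndex_eq φ k1 hxk (by simp [hw])
    have e2 : flipIndex φ k2 = m := flipIndex_eq φ k2 hwm (by simp [hz'])
    have key := prefixSign_anticomm (φ x) hx hxk hne
    rw [← hy, ← hw] at key
    simpa only [coverSign, hm, hk, e1, e2, prefixSign] using key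
  · intro t ht ht'
    obtain ⟨hxl, htl⟩ := flipIndex_spec φ ht
    generalize flipIndex φ ht = l at hxl htl
    have hzl : φ z l = true := by
      have h1 : φ t l ≤ φ z l := φ.monotone ht'.le l
      rw [htl, Function.update_self] at h1
      exact top_le_iff.1 h1
    by_cases hlm : l = m
    · left
      subst hlm
      exact φ.injective (htl.trans hy.symm)
    · by_cases hlk : l = k
      · right
        subst hlk
        exact φ.injective (htl.trans hw.symm)
      · rw [hz, hy] at hzl
        simp [hlm, hlk, hxl] at hzl

theorem rk_lt_rk [Finite L] {x y : L} (h : x < y) : rk x < rk y := by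
  have fin : ∀ z : L, Order.height z < ⊤ := by
    intro z
    have := Fintype.ofFinite L
    refine lt_of_le_of_lt (b := (Fintype.card L : ℕ∞)) ?_ (ENat.natCast_lt_top _)
    refine iSup₂_le fun p _ => ?_
    exact_mod_cast (LTSeries.length_lt_card p).le
  have lt := Order.height_strictMono h (fin x)
  rw [← ENat.natCast_toNat (fin x).ne, ← ENat.natCast_toNat (fin y).ne] at lt
  exact ENat.natCast_lt_natCast.1 lt

open Classical in
theorem cubeBoundary_of [Finite L] {r : ℕ} (φ : L ≃o (Fin r → Bool))
    (F : {x : L // x ≠ ⊤} ⥤ AddCommGrpCat.{v}) (n : ℤ) (x : Level L (n + 1)) (a : F.obj x.1) :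
    cubeBoundary φ F n (DirectSum.of (fun x : Level L (n + 1) => F.obj x.1) x a) =
      ∑ y : Level L n, if h : x.1.1 ⋖ y.1.1 then
        coverSign φ h • DirectSum.of (fun y : Level L n => F.obj y.1) y
          ((F.map (homOfLE (show x.1 ≤ y.1 from h.le))).hom a) else 0 := by
  rw [cubeBoundary, DirectSum.toAddMonoid_of, AddMonoidHom.finsetSum_apply]
  refine Finset.sum_congr rfl fun y _ => ?_
  split_ifs <;> rfl

theorem cubeBoundary_comp [Finite L] {r : ℕ} (φ : L ≃o (Fin r → Bool))
    (F : {x : L // x ≠ ⊤} ⥤ AddCommGrpCat.{v}) (n : ℤ) :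
    (cubeBoundary φ F n).comp (cubeBoundary φ F (n + 1)) = 0 := by
  classical
  refine DirectSum.addHom_ext fun x a => ?_
  rw [AddMonoidHom.comp_apply, cubeBoundary_of, map_sum, AddMonoidHom.zero_apply]
  have term : ∀ y : Level L (n + 1),
      cubeBoundary φ F n (if h : x.1.1 ⋖ y.1.1 then
        coverSign φ h • DirectSum.of (fun y : Level L (n + 1) => F.obj y.1) y
          ((F.map (homOfLE (show x.1 ≤ y.1 from h.le))).hom a) else 0) =
      ∑ z : Level L n, if h : x.1.1 ⋖ y.1.1 ∧ y.1.1 ⋖ z.1.1 then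
        (coverSign φ h.1 * coverSign φ h.2) • DirectSum.of (fun y : Level L n => F.obj y.1) z
          ((F.map (homOfLE (show x.1 ≤ z.1 from h.1.le.trans h.2.le))).hom a) else 0 := by
    intro y
    by_cases h : x.1.1 ⋖ y.1.1
    · rw [dif_pos h, map_zsmul, cubeBoundary_of, Finset.smul_sum]
      refine Finset.sum_congr rfl fun z _ => ?_
      by_cases h' : y.1.1 ⋖ z.1.1
      · rw [dif_pos h', dif_pos ⟨h, h'⟩, mul_smul,
          ← homOfLE_comp (show x.1 ≤ y.1 from h.le) (show y.1 ≤ z.1 from h'.le), F.map_comp]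
        rfl
      · rw [dif_neg h', dif_neg (fun k => h' k.2), smul_zero]
    · rw [dif_neg h, map_zero]
      refine (Finset.sum_eq_zero fun z _ => ?_).symm
      rw [dif_neg (fun k => h k.1)]
  rw [Finset.sum_congr rfl fun y _ => term y, Finset.sum_comm]
  refine Finset.sum_eq_zero fun z _ => ?_
  by_cases hy : ∃ y : Level L (n + 1), x.1.1 ⋖ y.1.1 ∧ y.1.1 ⋖ z.1.1
  · obtain ⟨y, h, h'⟩ := hy
    obtain ⟨w, k, k', hne, hsign, huniq⟩ := exists_diamond φ h h'
    have hw : (rk w : ℤ) = (rk (⊤ : L) : ℤ) - (n + 1) - 1 := by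
      have h1 := rk_lt_rk k.lt
      have h2 := rk_lt_rk k'.lt
      have h3 := x.2
      have h4 := z.2
      omega
    let w' : Level L (n + 1) := ⟨⟨w, (k'.lt.trans_le le_top).ne⟩, hw⟩
    rw [Finset.sum_eq_add (a := y) (b := w')]
    · rw [dif_pos ⟨h, h'⟩, dif_pos (show x.1.1 ⋖ w'.1.1 ∧ w'.1.1 ⋖ z.1.1 from ⟨k, k'⟩), ← add_smul]
      exact (congrArg (· • _) hsign).trans (zero_smul ℤ _)
    · intro e
      exact hne (congrArg (fun t : Level L (n + 1) => t.1.1) e).symm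
    · rintro t - ⟨hty, htw⟩
      refine dif_neg fun ht => ?_
      rcases huniq _ ht.1 ht.2 with e | e
      · exact hty (Subtype.ext (Subtype.ext e))
      · exact htw (Subtype.ext (Subtype.ext e))
    · simp
    · simp
  · refine Finset.sum_eq_zero fun y _ => ?_
    rw [dif_neg fun h => hy ⟨y, h⟩]

/-- The signed cube complex `C` with `Cₙ = ⨁_{x ∈ Dₙ} F x`, for all integers `n`. -/
noncomputable def cubeComplex [Finite L] {r : ℕ} (φ : L ≃o (Fin r → Bool))
    (F : {x : L // x ≠ ⊤} ⥤ AddCommGrpCat.{v}) : ChainComplex AddCommGrpCat.{max u v} ℤ :=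
  ChainComplex.of (fun n => AddCommGrpCat.of (⨁ x : Level L n, F.obj x.1))
    (fun n => AddCommGrpCat.ofHom (cubeBoundary φ F n)) fun n => by
      rw [← AddCommGrpCat.ofHom_comp, cubeBoundary_comp]
      rfl

end Cube

end PosetHomology

/-! Both `F ↦ C(X; F)`, with `X = L \ {⊤}`, and `F ↦` (cube complex) are degreewise direct sums of
evaluations, hence additive exact functors of the coefficients, and every short exact sequence of
functors gives a long exact homology sequence on each side. The isomorphism follows by dimension
shifting, from two facts.

Acyclicity: for `x ≠ ⊤` and a group `A`, let `coneFunctor x A` be `A` above `x` and `0` elsewhere.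
On it both complexes are exact in positive degrees. The order complex is contracted by prepending
`x` to a chain (`chainCone_homotopy`). The cube complex is contracted by lowering a fixed coordinate
`m` that is `0` in `x`, which exists because `x ≠ ⊤` (`cubeCone_homotopy`). Every `F` is a quotient
of a finite biproduct `P` of such functors (`epi_biproduct_desc_coneDesc`).

Degree zero: sending `a` in the summand of a coatom `y` to `ε(y ⋖ ⊤) a` on the vertex `y` induces an
isomorphism of the cokernels of the two last differentials, naturally in `F` (`homologyZeroIso`). On
both sides this cokernel is `colim F`.

With `0 → K → P → F → 0` exact, `H₁(F)` is the kernel of `H₀(K) → H₀(P)` and `Hₙ₊₂(F) ≅ Hₙ₊₁(K)` for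
both theories, so induction over all `F` at once finishes (`nonempty_homology_iso`). In negative
degrees both sides vanish. -/

namespace PosetHomology

/-! ### Exactness of direct sums of evaluations -/

section Sums

variable {X : Type u} [PartialOrder X] {ι : Type u}

/-- The homomorphism `⨁ i, F (m i) → ⨁ i, G (m i)` induced by a natural transformation. -/
noncomputable def sumMap (m : ι → X) {F G : X ⥤ AddCommGrpCat.{v}} (f : F ⟶ G) :
    (⨁ i, F.obj (m i)) →+ ⨁ i, G.obj (m i) :=
  DirectSum.map fun i => (f.app (m i)).hom

theorem sumMap_of [DecidableEq ι] (m : ι → X) {F G : X ⥤ AddCommGrpCat.{v}} (f : F ⟶ G)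
    (i : ι) (a : F.obj (m i)) :
    sumMap m f (DirectSum.of (fun i => F.obj (m i)) i a) =
      DirectSum.of (fun i => G.obj (m i)) i ((f.app (m i)).hom a) :=
  DirectSum.map_of _ _ _

/-- The functor `F ↦ ⨁ i, F (m i)`. -/
noncomputable def sumFunctor (m : ι → X) :
    (X ⥤ AddCommGrpCat.{v}) ⥤ AddCommGrpCat.{max u v} where
  obj F := AddCommGrpCat.of (⨁ i, F.obj (m i))
  map f := AddCommGrpCat.ofHom (sumMap m f)
  map_id _ := AddCommGrpCat.hom_ext DirectSum.map_id
  map_comp f g := AddCommGrpCat.hom_ext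
    (DirectSum.map_comp (fun i => (f.app (m i)).hom) (fun i => (g.app (m i)).hom))

theorem sumMap_add (m : ι → X) {F G : X ⥤ AddCommGrpCat.{v}} (f g : F ⟶ G) :
    sumMap m (f + g) = sumMap m f + sumMap m g := by
  classical
  refine DirectSum.addHom_ext fun i a => ?_
  rw [AddMonoidHom.add_apply, sumMap_of, sumMap_of, sumMap_of, ← map_add]
  rfl

instance (m : ι → X) : (sumFunctor.{u, v} m).Additive where
  map_add := AddCommGrpCat.hom_ext (sumMap_add m _ _)

/-- Preimages are chosen summand by summand, only over the finite support of `z`; elsewhere the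
preimage is `0`, so the choice is again an element of the direct sum. -/
theorem sumMap_exact (m : ι → X) {F G H : X ⥤ AddCommGrpCat.{v}} (f : F ⟶ G) (g : G ⟶ H)
    (h : ∀ i (a : G.obj (m i)), (g.app (m i)).hom a = 0 → ∃ b, (f.app (m i)).hom b = a)
    (z : ⨁ i, G.obj (m i)) (hz : sumMap m g z = 0) : ∃ y, sumMap m f y = z := by
  classical
  have key (i : ι) (hi : i ∈ DFinsupp.support z) :
      ∃ y : F.obj (m i), (f.app (m i)).hom y = z i :=
    h i (z i) (DFunLike.congr_fun hz i)
  choose y hy using key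
  let w : ⨁ i, F.obj (m i) := DFinsupp.mk (DFinsupp.support z) fun i => y i.1 i.2
  refine ⟨w, DFinsupp.ext fun i => ?_⟩
  change (f.app (m i)).hom (w i) = z i
  have hw : w i = if hi : i ∈ DFinsupp.support z then y i hi else 0 := DFinsupp.mk_apply
  rw [hw]
  split_ifs with hi
  · exact hy i hi
  · rw [map_zero, DFinsupp.notMem_support_iff.1 hi]

theorem sumFunctor_shortExact (m : ι → X) {S : ShortComplex (X ⥤ AddCommGrpCat.{v})}
    (hS : S.ShortExact) : (S.map (sumFunctor m)).ShortExact := by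
  have hx (x : X) : (S.map ((evaluation X AddCommGrpCat.{v}).obj x)).ShortExact :=
    hS.map_of_exact _
  refine { exact := ?_, mono_f := ?_, epi_g := ?_ }
  · rw [ShortComplex.ab_exact_iff]
    exact sumMap_exact m S.f S.g fun i => (ShortComplex.ab_exact_iff _).1 (hx (m i)).exact
  · exact (AddCommGrpCat.mono_iff_injective _).2
      ((DirectSum.map_injective _).2 fun i => (hx (m i)).ab_injective_f)
  · exact (AddCommGrpCat.epi_iff_surjective _).2
      ((DirectSum.map_surjective _).2 fun i => (hx (m i)).ab_surjective_g)

end Sums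

/-! ### The order complex as an exact functor of the coefficients -/

section OrderFunctor

variable {X : Type u} [PartialOrder X]

theorem orderComplexNat_d (F : X ⥤ AddCommGrpCat.{v}) (n : ℕ) :
    (orderComplexNat F).d (n + 1) n = AddCommGrpCat.ofHom (chainBoundary F n) :=
  ChainComplex.of_d (fun n => AddCommGrpCat.of (⨁ s : Chains X n, F.obj s.min))
    (fun n => AddCommGrpCat.ofHom (chainBoundary F n)) n

theorem chainBoundary_sumMap {F G : X ⥤ AddCommGrpCat.{v}} (f : F ⟶ G) (n : ℕ) :
    (chainBoundary G n).comp (sumMap Chains.min f) =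
      (sumMap Chains.min f).comp (chainBoundary F n) := by
  classical
  refine DirectSum.addHom_ext fun s a => ?_
  rw [AddMonoidHom.comp_apply, AddMonoidHom.comp_apply, sumMap_of, chainBoundary_of,
    chainBoundary_of, map_sum]
  refine Finset.sum_congr rfl fun i _ => ?_
  rw [map_zsmul, sumMap_of]
  congr 2
  exact ConcreteCategory.congr_hom (f.naturality (homOfLE (s.min_le_min_face i))).symm a

variable (X) in
/-- The complex `C(X; F)` in degrees `n ≥ 0`, as a functor of `F`. -/
noncomputable def orderFunctor :
    (X ⥤ AddCommGrpCat.{v}) ⥤ ChainComplex AddCommGrpCat.{max u v} ℕ where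
  obj F := orderComplexNat F
  map {F G} f := ChainComplex.ofHom
    (fun n => (sumFunctor fun s : Chains X n => s.min).map f) fun n => by
      rw [orderComplexNat_d, orderComplexNat_d]
      exact AddCommGrpCat.hom_ext (chainBoundary_sumMap f n)
  map_id F := by
    ext n : 1
    exact (sumFunctor fun s : Chains X n => s.min).map_id F
  map_comp f g := by
    ext n : 1
    exact (sumFunctor fun s : Chains X n => s.min).map_comp f g

instance : (orderFunctor.{u, v} X).Additive where
  map_add {F G f g} := by
    ext n : 1
    exact (sumFunctor fun s : Chains X n => s.min).map_add

theorem orderFunctor_shortExact {S : ShortComplex (X ⥤ AddCommGrpCat.{v})}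
    (hS : S.ShortExact) : (S.map (orderFunctor X)).ShortExact :=
  HomologicalComplex.shortExact_of_degreewise_shortExact _ fun n =>
    sumFunctor_shortExact (fun s : Chains X n => s.min) hS

end OrderFunctor

/-! ### The cube complex as an exact functor of the coefficients -/

section CubeFunctor

variable {L : Type u} [BooleanAlgebra L] [Finite L] {r : ℕ} (φ : L ≃o (Fin r → Bool))

theorem cubeComplex_d (F : {x : L // x ≠ ⊤} ⥤ AddCommGrpCat.{v}) (n : ℤ) :
    (cubeComplex φ F).d (n + 1) n = AddCommGrpCat.ofHom (cubeBoundary φ F n) :=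
  ChainComplex.of_d (fun n => AddCommGrpCat.of (⨁ x : Level L n, F.obj x.1))
    (fun n => AddCommGrpCat.ofHom (cubeBoundary φ F n)) n

theorem cubeBoundary_sumMap {F G : {x : L // x ≠ ⊤} ⥤ AddCommGrpCat.{v}} (f : F ⟶ G) (n : ℤ) :
    (cubeBoundary φ G n).comp (sumMap (fun x : Level L (n + 1) => x.1) f) =
      (sumMap (fun x : Level L n => x.1) f).comp (cubeBoundary φ F n) := by
  classical
  refine DirectSum.addHom_ext fun x a => ?_
  rw [AddMonoidHom.comp_apply, AddMonoidHom.comp_apply, sumMap_of, cubeBoundary_of,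
    cubeBoundary_of, map_sum]
  refine Finset.sum_congr rfl fun y _ => ?_
  split_ifs with h
  · rw [map_zsmul, sumMap_of]
    congr 2
    exact ConcreteCategory.congr_hom
      (f.naturality (homOfLE (show x.1 ≤ y.1 from h.le))).symm a
  · rw [map_zero]

/-- The signed cube complex as a functor of the coefficients. -/
noncomputable def cubeFunctor :
    ({x : L // x ≠ ⊤} ⥤ AddCommGrpCat.{v}) ⥤ ChainComplex AddCommGrpCat.{max u v} ℤ where
  obj F := cubeComplex φ F
  map {F G} f := ChainComplex.ofHom
    (fun n => (sumFunctor fun x : Level L n => x.1).map f) fun n => by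
      rw [cubeComplex_d, cubeComplex_d]
      exact AddCommGrpCat.hom_ext (cubeBoundary_sumMap φ f n)
  map_id F := by
    ext n : 1
    exact (sumFunctor fun x : Level L n => x.1).map_id F
  map_comp f g := by
    ext n : 1
    exact (sumFunctor fun x : Level L n => x.1).map_comp f g

instance : (cubeFunctor.{u, v} φ).Additive where
  map_add {F G f g} := by
    ext n : 1
    exact (sumFunctor fun x : Level L n => x.1).map_add

theorem cubeFunctor_shortExact {S : ShortComplex ({x : L // x ≠ ⊤} ⥤ AddCommGrpCat.{v})}
    (hS : S.ShortExact) : (S.map (cubeFunctor φ)).ShortExact :=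
  HomologicalComplex.shortExact_of_degreewise_shortExact _ fun n =>
    sumFunctor_shortExact (fun x : Level L n => x.1) hS

end CubeFunctor

/-! ### Cone functors and the resolution of an arbitrary functor by them -/

section ConeFunctor

variable {X : Type u} [PartialOrder X]

/-- The functor with value `A` on the elements above `x` and `0` elsewhere, realised by subgroups
of `A`. -/
def coneFunctor (x : X) (A : AddCommGrpCat.{v}) : X ⥤ AddCommGrpCat.{v} where
  obj y := AddCommGrpCat.of
    -- Since every value is a subgroup of the same `A`, the transition maps are plain inclusions and
    -- no case distinction between `A` and `0` enters the types.
    ({ carrier := {a | x ≤ y ∨ a = 0}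
       zero_mem' := Or.inr rfl
       add_mem' := by
        rintro a b (h | rfl) (k | rfl)
        exacts [Or.inl h, Or.inl h, Or.inl k, Or.inr (add_zero 0)]
       neg_mem' := by
        rintro a (h | rfl)
        exacts [Or.inl h, Or.inr neg_zero] } : AddSubgroup A)
  map f := AddCommGrpCat.ofHom (AddSubgroup.inclusion fun _ h => h.imp_left fun k => k.trans f.le)

/-- The natural map from the cone functor of `F x` at `x` to `F`. -/
noncomputable def coneDesc (F : X ⥤ AddCommGrpCat.{v}) (x : X) :
    coneFunctor x (F.obj x) ⟶ F := by
  classical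
  exact
  { app y := AddCommGrpCat.ofHom
      (if h : x ≤ y then (F.map (homOfLE h)).hom.comp (AddSubgroup.subtype _) else 0)
    naturality y z f := by
      refine AddCommGrpCat.hom_ext (AddMonoidHom.ext ?_)
      rintro ⟨a, h⟩
      by_cases hy : x ≤ y
      · have hz : x ≤ z := hy.trans f.le
        have e : F.map (homOfLE hz) = F.map (homOfLE hy) ≫ F.map f := by
          rw [← F.map_comp]
          rfl
        rw [dif_pos hy, dif_pos hz, e]
        rfl
      · obtain rfl : a = 0 := h.resolve_left hy
        exact (map_zero ((coneFunctor x (F.obj x)).map f ≫ _).hom).trans (map_zero _).symm }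

theorem coneDesc_app_surjective (F : X ⥤ AddCommGrpCat.{v}) (x : X) :
    Function.Surjective ((coneDesc F x).app x).hom := by
  intro a
  refine ⟨⟨a, Or.inl le_rfl⟩, ?_⟩
  simp only [coneDesc, dif_pos (le_refl x)]
  exact ConcreteCategory.congr_hom (F.map_id x) a

instance : Limits.HasFiniteBiproducts (X ⥤ AddCommGrpCat.{v}) :=
  Abelian.hasFiniteBiproducts

/-- At the point `x`, the summand indexed by `x` alone already surjects onto `F x`. -/
theorem epi_biproduct_desc_coneDesc [Finite X] (F : X ⥤ AddCommGrpCat.{v}) :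
    Epi (Limits.biproduct.desc (coneDesc F)) := by
  refine NatTrans.epi_iff_epi_app _ |>.2 fun x => ?_
  have h : Epi ((coneDesc F x).app x) :=
    (AddCommGrpCat.epi_iff_surjective _).2 (coneDesc_app_surjective F x)
  rw [← Limits.biproduct.ι_desc (coneDesc F) x, NatTrans.comp_app] at h
  exact epi_of_epi ((Limits.biproduct.ι (fun y => coneFunctor y (F.obj y)) x).app x) _

end ConeFunctor

/-! ### Calculus in direct sums of values of a cone functor -/

section ConeSums

variable {X : Type u} [PartialOrder X] {ι : Type u} (x : X) (A : AddCommGrpCat.{v}) (m : ι → X)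

open Classical in
/-- The element `a` of the `i`-th summand of `⨁ i, coneFunctor x A (m i)`, or `0` if this summand
vanishes. -/
noncomputable def coneOf (i : ι) : A →+ ⨁ i, (coneFunctor x A).obj (m i) :=
  if h : x ≤ m i then
    (DirectSum.of (fun i => (coneFunctor x A).obj (m i)) i).comp
      ((AddMonoidHom.id A).codRestrict
        ({ carrier := {a | x ≤ m i ∨ a = 0}
           zero_mem' := Or.inr rfl
           add_mem' := fun _ _ => Or.inl h
           neg_mem' := fun _ => Or.inl h } : AddSubgroup A) fun _ => Or.inl h)
  else 0

variable {x A}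

-- Passing to `coneOf` removes the membership proofs: transition maps fix the underlying element of
-- `A`, so boundaries and contractions become formulas with one fixed `a : A`.
open Classical in
theorem of_eq_coneOf (i : ι) (a : (coneFunctor x A).obj (m i)) :
    DirectSum.of (fun i => (coneFunctor x A).obj (m i)) i a = coneOf x A m i a.1 := by
  by_cases h : x ≤ m i
  · rw [coneOf, dif_pos h]
    rfl
  · have ha : a = 0 := Subtype.ext (a.2.resolve_left h)
    rw [ha, map_zero]
    exact (map_zero (coneOf x A m i)).symm

theorem coneSum_ext {B : Type*} [AddCommGroup B]
    {f g : (⨁ i, (coneFunctor x A).obj (m i)) →+ B}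
    (h : ∀ i, x ≤ m i → ∀ a, f (coneOf x A m i a) = g (coneOf x A m i a)) : f = g := by
  classical
  refine DirectSum.addHom_ext fun i a => ?_
  rw [of_eq_coneOf]
  by_cases hi : x ≤ m i
  · exact h i hi _
  · rw [coneOf, dif_neg hi, AddMonoidHom.zero_apply, map_zero, map_zero]

open Classical in
/-- The homomorphism out of `⨁ i, coneFunctor x A (m i)` given on summands by homomorphisms out of
`A`. -/
noncomputable def coneLift {B : Type*} [AddCommGroup B] (f : ι → A →+ B) :
    (⨁ i, (coneFunctor x A).obj (m i)) →+ B :=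
  DirectSum.toAddMonoid fun i => (f i).comp (AddSubgroup.subtype _)

theorem coneLift_coneOf {B : Type*} [AddCommGroup B] (f : ι → A →+ B) {i : ι} (hi : x ≤ m i)
    (a : A) : coneLift m f (coneOf x A m i a) = f i a := by
  classical
  rw [← of_eq_coneOf m i ⟨a, Or.inl hi⟩]
  exact DirectSum.toAddMonoid_of _ _ _

end ConeSums

/-! ### Acyclicity of the order complex on cone functors -/

section OrderAcyclic

variable {X : Type u} [PartialOrder X] {x : X} {A : AddCommGrpCat.{v}}

/-- The chain `x < x₀ < ⋯ < xₙ`. -/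
def Chains.cons {n : ℕ} (s : Chains X n) (h : x < s.min) : Chains X (n + 1) :=
  ⟨Fin.cons x s.1, Fin.strictMono_iff_lt_succ.2 <| Fin.cases h fun i =>
    s.2 i.castSucc_lt_succ⟩

theorem Chains.cons_face_zero {n : ℕ} (s : Chains X n) (h : x < s.min) :
    (s.cons h).face 0 = s :=
  Subtype.ext <| funext fun _ => rfl

theorem Chains.cons_face_succ {n : ℕ} (s : Chains X (n + 1)) (h : x < s.min) (i : Fin (n + 2)) :
    (s.cons h).face i.succ = (s.face i).cons (h.trans_le (s.min_le_min_face i)) := by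
  refine Subtype.ext <| funext fun j => ?_
  refine Fin.cases ?_ (fun j => ?_) j
  · rfl
  · change (Fin.cons x s.1 : Fin (n + 3) → X) (i.succ.succAbove j.succ) = s.1 (i.succAbove j)
    rw [Fin.succ_succAbove_succ, Fin.cons_succ]

theorem Chains.lt_min_face_zero {n : ℕ} (s : Chains X (n + 1)) : s.min < (s.face 0).min :=
  s.2 (Fin.succ_pos 0)

theorem Chains.face_zero_cons {n : ℕ} (s : Chains X (n + 1)) :
    (s.face 0).cons s.lt_min_face_zero = s :=
  Subtype.ext (Fin.cons_self_tail s.1)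

theorem Chains.min_face_succ {n : ℕ} (s : Chains X (n + 1)) (i : Fin (n + 1)) :
    (s.face i.succ).min = s.min :=
  congrArg s.1 (Fin.succ_succAbove_zero i)

theorem chainBoundary_coneOf {n : ℕ} (s : Chains X (n + 1)) (a : A) (hs : x ≤ s.min) :
    chainBoundary (coneFunctor x A) n (coneOf x A Chains.min s a) =
      ∑ i : Fin (n + 2), (-1 : ℤ) ^ (i : ℕ) • coneOf x A Chains.min (s.face i) a := by
  classical
  suffices h : ∀ b : (coneFunctor x A).obj s.min,
      chainBoundary (coneFunctor x A) n (coneOf x A Chains.min s b.1) =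
        ∑ i : Fin (n + 2), (-1 : ℤ) ^ (i : ℕ) • coneOf x A Chains.min (s.face i) b.1 from
    h ⟨a, Or.inl hs⟩
  intro b
  rw [← of_eq_coneOf, chainBoundary_of]
  refine Finset.sum_congr rfl fun i _ => ?_
  rw [of_eq_coneOf]
  rfl

open Classical in
variable (x A) in
/-- The cone contraction `s ↦ x < s` of the order complex with coefficients in a cone functor. -/
noncomputable def chainCone (n : ℕ) :
    (⨁ s : Chains X n, (coneFunctor x A).obj s.min) →+
      ⨁ s : Chains X (n + 1), (coneFunctor x A).obj s.min :=
  coneLift Chains.min fun s => if h : x < s.min then coneOf x A Chains.min (s.cons h) else 0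

theorem chainCone_coneOf_of_lt {n : ℕ} (s : Chains X n) (h : x < s.min) (a : A) :
    chainCone x A n (coneOf x A Chains.min s a) = coneOf x A Chains.min (s.cons h) a := by
  rw [chainCone, coneLift_coneOf _ _ h.le, dif_pos h]

theorem chainCone_coneOf_of_eq {n : ℕ} (s : Chains X n) (h : x = s.min) (a : A) :
    chainCone x A n (coneOf x A Chains.min s a) = 0 := by
  rw [chainCone, coneLift_coneOf _ _ h.le, dif_neg h.not_lt, AddMonoidHom.zero_apply]

/-- If `x < min s`, the zeroth face of `x < s` is `s`, and its other faces cancel against the cones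
on the faces of `s`. If `x = min s`, the cone on `s` is `0`; among the faces of `s` only the zeroth
has minimum different from `x`, and its cone is `s`. -/
theorem chainCone_homotopy (n : ℕ) :
    (chainBoundary (coneFunctor x A) (n + 1)).comp (chainCone x A (n + 1)) +
      (chainCone x A n).comp (chainBoundary (coneFunctor x A) n) = AddMonoidHom.id _ := by
  refine coneSum_ext _ fun s hs a => ?_
  rw [AddMonoidHom.add_apply, AddMonoidHom.comp_apply, AddMonoidHom.comp_apply,
    chainBoundary_coneOf s a hs, map_sum, AddMonoidHom.id_apply]
  rcases hs.lt_or_eq with h | h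
  · rw [chainCone_coneOf_of_lt s h, chainBoundary_coneOf (x := x) (s.cons h) a le_rfl,
      Fin.sum_univ_succ, Chains.cons_face_zero]
    rw [Fin.val_zero, pow_zero, one_smul, add_assoc, ← Finset.sum_add_distrib]
    refine add_eq_left.2 (Finset.sum_eq_zero fun i _ => ?_)
    rw [map_zsmul, chainCone_coneOf_of_lt _ (h.trans_le (s.min_le_min_face i)),
      Chains.cons_face_succ, Fin.val_succ, pow_succ]
    simp
  · rw [chainCone_coneOf_of_eq s h, map_zero, zero_add, Fin.sum_univ_succ,
      Finset.sum_eq_zero, add_zero, Fin.val_zero, pow_zero, one_smul]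
    · subst h
      rw [chainCone_coneOf_of_lt _ s.lt_min_face_zero, s.face_zero_cons]
    · intro i _
      rw [map_zsmul, chainCone_coneOf_of_eq _ (h.trans (s.min_face_succ i).symm), smul_zero]

theorem chainBoundary_chainCone {n : ℕ}
    (z : ⨁ s : Chains X (n + 1), (coneFunctor x A).obj s.min)
    (hz : chainBoundary (coneFunctor x A) n z = 0) :
    chainBoundary (coneFunctor x A) (n + 1) (chainCone x A (n + 1) z) = z := by
  have key := DFunLike.congr_fun (chainCone_homotopy (x := x) (A := A) n) z
  rwa [AddMonoidHom.add_apply, AddMonoidHom.comp_apply, AddMonoidHom.comp_apply, hz, map_zero,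
    add_zero] at key

theorem orderFunctor_coneFunctor_exactAt (x : X) (A : AddCommGrpCat.{v}) (n : ℕ) :
    ((orderFunctor X).obj (coneFunctor x A)).ExactAt (n + 1) := by
  rw [HomologicalComplex.exactAt_iff' _ (n + 2) (n + 1) n (by simp) (by simp),
    ShortComplex.ab_exact_iff]
  intro z hz
  change ((orderComplexNat (coneFunctor x A)).d (n + 1) n).hom z = 0 at hz
  rw [orderComplexNat_d] at hz
  refine ⟨chainCone x A (n + 1) z, ?_⟩
  change ((orderComplexNat (coneFunctor x A)).d (n + 1 + 1) (n + 1)).hom _ = z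
  rw [orderComplexNat_d]
  exact chainBoundary_chainCone z hz

end OrderAcyclic

/-! ### Rank in coordinates -/

section Rank

variable {L : Type u} [BooleanAlgebra L] {r : ℕ} (φ : L ≃o (Fin r → Bool))

theorem exists_covBy_of_apply_eq_true {y : L} {m : Fin r} (h : φ y m = true) :
    ∃ (w : L) (k : w ⋖ y), flipIndex φ k = m ∧ φ w = Function.update (φ y) m false := by
  have hw := φ.apply_symm_apply (Function.update (φ y) m false)
  generalize φ.symm (Function.update (φ y) m false) = w at hw
  have hwm : φ w m = false := by simp [hw]
  have k : w ⋖ y := covBy_of_update φ hwm (by simp [hw, ← h])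
  exact ⟨w, k, flipIndex_eq φ k hwm h, hw⟩

theorem exists_covBy_of_apply_eq_false {y : L} {m : Fin r} (h : φ y m = false) :
    ∃ (z : L) (k : y ⋖ z), flipIndex φ k = m ∧ φ z = Function.update (φ y) m true := by
  have hz := φ.apply_symm_apply (Function.update (φ y) m true)
  generalize φ.symm (Function.update (φ y) m true) = z at hz
  have k : y ⋖ z := covBy_of_update φ h hz
  exact ⟨z, k, flipIndex_eq φ k h (by simp [hz]), hz⟩

theorem exists_apply_eq_false {x : L} (hx : x ≠ ⊤) : ∃ m, φ x m = false := by
  by_contra! h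
  refine hx (φ.injective ?_)
  rw [map_top]
  exact funext fun m => by simpa using h m

theorem card_filter_update_true {b : Fin r → Bool} {m : Fin r} (h : b m = false) :
    (Finset.univ.filter fun j => Function.update b m true j = true).card =
      (Finset.univ.filter fun j => b j = true).card + 1 := by
  rw [← Finset.card_insert_of_notMem (a := m) (by simp [h])]
  congr 1
  ext j
  by_cases hj : j = m
  · subst hj; simp
  · simp [hj]

/-- The number of coordinates equal to `1` is a strictly monotone function to `ℕ`, which bounds the
height from above; switching off ones one at a time gives the reverse inequality. -/
theorem rk_eq_card [Finite L] (y : L) :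
    rk y = (Finset.univ.filter fun j => φ y j = true).card := by
  refine le_antisymm ?_ ?_
  · have mono : StrictMono fun y : L => (Finset.univ.filter fun j => φ y j = true).card := by
      intro y z h
      refine Finset.card_lt_card (Finset.ssubset_iff_of_subset ?_ |>.2 ?_)
      · intro j
        simp only [Finset.mem_filter, Finset.mem_univ, true_and]
        intro hj
        have := φ.monotone h.le j
        rw [hj] at this
        exact top_le_iff.1 this
      · obtain ⟨-, j, hj⟩ := Pi.lt_def.1 ((OrderIso.lt_iff_lt φ).2 h)
        refine ⟨j, ?_⟩
        revert hj
        simp only [Finset.mem_filter, Finset.mem_univ, true_and]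
        cases φ y j <;> cases φ z j <;> decide
    have := Order.height_le_height_apply_of_strictMono _ mono y
    rw [Order.height_nat] at this
    exact ENat.toNat_le_of_le_natCast this
  · generalize hn : (Finset.univ.filter fun j => φ y j = true).card = n
    induction n generalizing y with
    | zero => exact Nat.zero_le _
    | succ n ih =>
      obtain ⟨m, hm⟩ := Finset.card_pos.1 (hn.symm ▸ Nat.succ_pos n :
        0 < (Finset.univ.filter fun j => φ y j = true).card)
      have hm' : φ y m = true := (Finset.mem_filter.1 hm).2
      obtain ⟨w, k, -, hw⟩ := exists_covBy_of_apply_eq_true φ hm'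
      refine (Nat.succ_le_succ (ih w ?_)).trans (rk_lt_rk k.lt)
      have hy : Function.update (φ w) m true = φ y := by simp [hw, ← hm']
      have := card_filter_update_true (b := φ w) (m := m) (by simp [hw])
      rw [hy, hn] at this
      omega

theorem rk_covBy [Finite L] (φ : L ≃o (Fin r → Bool)) {x y : L} (h : x ⋖ y) : rk y = rk x + 1 := by
  obtain ⟨h1, h2⟩ := flipIndex_spec φ h
  rw [rk_eq_card φ, rk_eq_card φ, h2, card_filter_update_true h1]

theorem coverSign_mul_self {x y : L} (h : x ⋖ y) : coverSign φ h * coverSign φ h = 1 := by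
  rw [coverSign, ← Finset.prod_mul_distrib]
  refine Finset.prod_eq_one fun j _ => ?_
  rw [← mul_pow]
  simp

end Rank

/-! ### Incidence numbers and the contraction identity of the cube -/

section CubeCone

variable {L : Type u} [BooleanAlgebra L] {r : ℕ} (φ : L ≃o (Fin r → Bool))

open Classical in
/-- The incidence number `ε(x ⋖ y)`, extended by `0`. -/
noncomputable def incidence (x y : L) : ℤ :=
  if h : x ⋖ y then coverSign φ h else 0

open Classical in
/-- The incidence number `ε(x ⋖ y)` if `x` and `y` differ in the coordinate `m`, and `0` otherwise. -/
noncomputable def incidenceAt (m : Fin r) (x y : L) : ℤ :=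
  if h : x ⋖ y then if flipIndex φ h = m then coverSign φ h else 0 else 0

variable {φ}

theorem incidence_of_covBy {x y : L} (h : x ⋖ y) : incidence φ x y = coverSign φ h :=
  dif_pos h

theorem incidenceAt_of_covBy {m : Fin r} {x y : L} (h : x ⋖ y) (hm : flipIndex φ h = m) :
    incidenceAt φ m x y = coverSign φ h := by
  rw [incidenceAt, dif_pos h, if_pos hm]

theorem covBy_of_incidence_ne_zero {x y : L} (h : incidence φ x y ≠ 0) : x ⋖ y := by
  by_contra hxy
  exact h (dif_neg hxy)

theorem covBy_of_incidenceAt_ne_zero {m : Fin r} {x y : L} (h : incidenceAt φ m x y ≠ 0) :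
    ∃ k : x ⋖ y, flipIndex φ k = m := by
  by_contra! hxy
  refine h ?_
  rw [incidenceAt]
  split_ifs with h1 h2
  · exact absurd h2 (hxy h1)
  · rfl
  · rfl

theorem flipIndex_ne_of_covBy_of_covBy {w y z : L} (hy : w ⋖ y) (hz : w ⋖ z) (hne : y ≠ z) :
    flipIndex φ hy ≠ flipIndex φ hz := by
  intro h
  refine hne (φ.injective ?_)
  rw [(flipIndex_spec φ hy).2, (flipIndex_spec φ hz).2, h]

theorem eq_update_false {x y : L} (h : x ⋖ y) :
    φ x = Function.update (φ y) (flipIndex φ h) false := by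
  obtain ⟨h1, h2⟩ := flipIndex_spec φ h
  rw [h2, Function.update_idem, ← h1, Function.update_eq_self]

/-- Completes the square downwards: `w` is `p` with both coordinates switched off. `exists_upper` is
the dual. -/
theorem exists_lower {m : Fin r} {y z p : L} (hy : y ⋖ p) (hz : z ⋖ p) (hm : flipIndex φ hz = m)
    (hne : y ≠ z) : ∃ (w : L) (k : w ⋖ y), flipIndex φ k = m ∧ w ⋖ z := by
  have h1 := eq_update_false (φ := φ) hy
  have h2 := eq_update_false (φ := φ) hz
  obtain ⟨-, h3⟩ := flipIndex_spec φ hy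
  obtain ⟨-, h4⟩ := flipIndex_spec φ hz
  rw [hm] at h2 h4
  generalize flipIndex φ hy = k at h1 h3
  have hkm : k ≠ m := by
    rintro rfl
    exact hne (φ.injective (h1.trans h2.symm))
  have hpm : φ p m = true := by rw [h4, Function.update_self]
  have hpk : φ p k = true := by rw [h3, Function.update_self]
  obtain ⟨w, hw, hwm, e⟩ := exists_covBy_of_apply_eq_true φ (y := y) (m := m)
    (by rw [h1, Function.update_of_ne hkm.symm, hpm])
  refine ⟨w, hw, hwm, covBy_of_update φ (m := k) (by rw [e, h1]; simp [hkm]) ?_⟩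
  rw [e, h1, h2, Function.update_comm hkm, Function.update_idem, Function.update_comm hkm.symm,
    ← hpk, Function.update_eq_self]

theorem exists_upper {m : Fin r} {w y z : L} (hy : w ⋖ y) (hz : w ⋖ z) (hm : flipIndex φ hy = m)
    (hne : y ≠ z) : ∃ (p : L) (k : z ⋖ p), flipIndex φ k = m ∧ y ⋖ p := by
  obtain ⟨h1, h2⟩ := flipIndex_spec φ hy
  obtain ⟨h3, h4⟩ := flipIndex_spec φ hz
  have hkm := flipIndex_ne_of_covBy_of_covBy (φ := φ) hy hz hne
  rw [hm] at h1 h2 hkm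
  generalize flipIndex φ hz = k at h3 h4 hkm
  obtain ⟨p, hp, hpm, e⟩ := exists_covBy_of_apply_eq_false φ (y := z) (m := m)
    (by rw [h4, Function.update_of_ne hkm, h1])
  refine ⟨p, hp, hpm, covBy_of_update φ (m := k) (by rw [h2]; simp [hkm.symm, h3]) ?_⟩
  rw [e, h4, h2, Function.update_comm hkm]

/-- The anticommutation in `exists_diamond`, multiplied by `ε(w ⋖ y) ε(z ⋖ p)` and simplified using
that signs square to `1`. -/
theorem coverSign_diamond {w y z p : L} (hwy : w ⋖ y) (hwz : w ⋖ z) (hyp : y ⋖ p) (hzp : z ⋖ p)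
    (hne : y ≠ z) :
    coverSign φ hyp * coverSign φ hzp + coverSign φ hwy * coverSign φ hwz = 0 := by
  obtain ⟨t, k, k', -, h, huniq⟩ := exists_diamond φ hwy hyp
  obtain rfl : z = t := (huniq z hwz hzp).resolve_left hne.symm
  linear_combination coverSign φ hwy * coverSign φ hzp * h -
    coverSign φ hyp * coverSign φ hzp * coverSign_mul_self φ hwy -
    coverSign φ hwy * coverSign φ hwz * coverSign_mul_self φ hzp

/-- Lowering coordinate `m` does not leave the cone above `x`, because `x` is already `0` there.
This is what makes the contraction defined on cone functors. -/
theorem le_of_incidenceAt_ne_zero {m : Fin r} {x w y : L} (hx : φ x m = false)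
    (h : incidenceAt φ m w y ≠ 0) (hxy : x ≤ y) : x ≤ w := by
  obtain ⟨k, hk⟩ := covBy_of_incidenceAt_ne_zero h
  refine (OrderIso.le_iff_le φ).1 fun j => ?_
  rw [eq_update_false k, hk]
  by_cases hj : j = m
  · subst hj
    rw [hx]
    exact bot_le
  · rw [Function.update_of_ne hj]
    exact φ.monotone hxy j

variable [Finite L]

theorem exists_level_succ_of_covBy {n : ℤ} (φ : L ≃o (Fin r → Bool)) (y : Level L n) {w : L}
    (h : w ⋖ y.1.1) : ∃ w' : Level L (n + 1), w'.1.1 = w := by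
  have h1 := rk_covBy φ h
  have h2 := y.2
  exact ⟨⟨⟨w, (h.lt.trans_le le_top).ne⟩, by dsimp only; omega⟩, rfl⟩

/-- With `n ≥ 0`, `y` has corank at least two, so its cover `p` cannot be the removed element `⊤`.
This confines the contraction to positive degrees. -/
theorem exists_level_of_covBy {n : ℕ} (φ : L ≃o (Fin r → Bool)) (y : Level L ((n : ℤ) + 1)) {p : L}
    (h : y.1.1 ⋖ p) : ∃ p' : Level L n, p'.1.1 = p := by
  have h1 := rk_covBy φ h
  have h2 := y.2
  refine ⟨⟨⟨p, ?_⟩, by dsimp only; omega⟩, rfl⟩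
  rintro rfl
  omega

/-- The matrix entries of the homotopy identity. On the diagonal exactly one term survives, a
squared sign: raise `m` if `y` is `0` there, lower it otherwise. Off the diagonal a nonzero term
forces a square `w ⋖ y, z ⋖ p` with `w ⋖ y` and `z ⋖ p` in direction `m`; each sum then has one
term, and the two cancel by `coverSign_diamond`. -/
theorem sum_incidence_mul_incidenceAt [DecidableEq L] {n : ℕ} (m : Fin r)
    (y z : Level L ((n : ℤ) + 1)) :
    ∑ w : Level L ((n : ℤ) + 1 + 1), incidenceAt φ m w.1.1 y.1.1 * incidence φ w.1.1 z.1.1 +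
      ∑ p : Level L n, incidence φ y.1.1 p.1.1 * incidenceAt φ m z.1.1 p.1.1 =
      if y.1.1 = z.1.1 then 1 else 0 := by
  refine (add_comm _ _).trans ?_
  have inj {k : ℤ} {a b : Level L k} (h : a.1.1 = b.1.1) : a = b := Subtype.ext (Subtype.ext h)
  split_ifs with hyz
  · obtain rfl := inj hyz
    cases hm : φ y.1.1 m
    · obtain ⟨p, hp, hpm, -⟩ := exists_covBy_of_apply_eq_false φ hm
      obtain ⟨p, rfl⟩ := exists_level_of_covBy φ y hp
      rw [Finset.sum_eq_single p, incidence_of_covBy hp, incidenceAt_of_covBy hp hpm,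
        coverSign_mul_self, Finset.sum_eq_zero, add_zero]
      · intro w _
        refine mul_eq_zero_of_left ?_ _
        by_contra h
        obtain ⟨k, hk⟩ := covBy_of_incidenceAt_ne_zero h
        rw [(flipIndex_spec φ k).2, hk, Function.update_self] at hm
        exact Bool.false_ne_true hm.symm
      · intro q _ hq
        refine mul_eq_zero_of_right _ ?_
        by_contra h
        obtain ⟨k, hk⟩ := covBy_of_incidenceAt_ne_zero h
        refine hq (inj (φ.injective ?_))
        rw [(flipIndex_spec φ k).2, (flipIndex_spec φ hp).2, hk, hpm]
      · simp
    · obtain ⟨w, hw, hwm, e⟩ := exists_covBy_of_apply_eq_true φ hm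
      obtain ⟨w, rfl⟩ := exists_level_succ_of_covBy φ y hw
      rw [Finset.sum_eq_zero, zero_add, Finset.sum_eq_single w, incidence_of_covBy hw,
        incidenceAt_of_covBy hw hwm, coverSign_mul_self]
      · intro v _ hv
        refine mul_eq_zero_of_left ?_ _
        by_contra h
        obtain ⟨k, hk⟩ := covBy_of_incidenceAt_ne_zero h
        refine hv (inj (φ.injective ?_))
        rw [eq_update_false k, e, hk]
      · simp
      · intro q _
        refine mul_eq_zero_of_right _ ?_
        by_contra h
        obtain ⟨k, hk⟩ := covBy_of_incidenceAt_ne_zero h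
        rw [← hk, (flipIndex_spec φ k).1] at hm
        exact Bool.false_ne_true hm
  · by_cases hw : ∃ (w : L) (k : w ⋖ y.1.1), flipIndex φ k = m ∧ w ⋖ z.1.1
    · obtain ⟨w, hwy, hwm, hwz⟩ := hw
      obtain ⟨p, hzp, hpm, hyp⟩ := exists_upper hwy hwz hwm hyz
      obtain ⟨p, rfl⟩ := exists_level_of_covBy φ y hyp
      obtain ⟨w, rfl⟩ := exists_level_succ_of_covBy φ y hwy
      rw [Finset.sum_eq_single p, Finset.sum_eq_single w, incidence_of_covBy hyp,
        incidence_of_covBy hwz, incidenceAt_of_covBy hzp hpm, incidenceAt_of_covBy hwy hwm]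
      · exact coverSign_diamond hwy hwz hyp hzp hyz
      · intro v _ hv
        by_contra h
        obtain ⟨k, -⟩ := covBy_of_incidenceAt_ne_zero (left_ne_zero_of_mul h)
        have k' := covBy_of_incidence_ne_zero (right_ne_zero_of_mul h)
        -- A common lower cover of `y ≠ z` must be `y ⊓ z`; the sums over `p` use `y ⊔ z` in the
        -- same way.
        exact hv (inj ((k.wcovBy.inf_eq k'.wcovBy hyz).symm.trans (hwy.wcovBy.inf_eq hwz.wcovBy hyz)))
      · simp
      · intro q _ hq
        by_contra h
        obtain ⟨k, -⟩ := covBy_of_incidenceAt_ne_zero (right_ne_zero_of_mul h)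
        have k' := covBy_of_incidence_ne_zero (left_ne_zero_of_mul h)
        exact hq (inj ((k'.wcovBy.sup_eq k.wcovBy hyz).symm.trans (hyp.wcovBy.sup_eq hzp.wcovBy hyz)))
      · simp
    · rw [Finset.sum_eq_zero, Finset.sum_eq_zero, add_zero]
      · intro v _
        by_contra h
        obtain ⟨k, hk⟩ := covBy_of_incidenceAt_ne_zero (left_ne_zero_of_mul h)
        exact hw ⟨_, k, hk, covBy_of_incidence_ne_zero (right_ne_zero_of_mul h)⟩
      · intro q _
        by_contra h
        obtain ⟨k, hk⟩ := covBy_of_incidenceAt_ne_zero (right_ne_zero_of_mul h)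
        exact hw (exists_lower (covBy_of_incidence_ne_zero (left_ne_zero_of_mul h)) k hk hyz)

end CubeCone

/-! ### Acyclicity of the cube complex on cone functors -/

section CubeAcyclic

variable {L : Type u} [BooleanAlgebra L] [Finite L] {r : ℕ} {φ : L ≃o (Fin r → Bool)}
  {x : {x : L // x ≠ ⊤}} {A : AddCommGrpCat.{v}}

theorem cubeBoundary_coneOf {n : ℤ} (y : Level L (n + 1)) (a : A) (hy : x ≤ y.1) :
    cubeBoundary φ (coneFunctor x A) n (coneOf x A (fun y : Level L (n + 1) => y.1) y a) =
      ∑ z : Level L n, incidence φ y.1.1 z.1.1 • coneOf x A (fun y : Level L n => y.1) z a := by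
  classical
  suffices h : ∀ b : (coneFunctor x A).obj y.1,
      cubeBoundary φ (coneFunctor x A) n (coneOf x A (fun y : Level L (n + 1) => y.1) y b.1) =
        ∑ z : Level L n, incidence φ y.1.1 z.1.1 •
          coneOf x A (fun y : Level L n => y.1) z b.1 from
    h ⟨a, Or.inl hy⟩
  intro b
  rw [← of_eq_coneOf (fun y : Level L (n + 1) => y.1), cubeBoundary_of]
  refine Finset.sum_congr rfl fun z _ => ?_
  rw [incidence]
  split_ifs with h
  · rw [of_eq_coneOf (fun y : Level L n => y.1)]
    rfl
  · rw [zero_smul]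

variable (φ x A) in
/-- The contraction, in the direction of the coordinate `m`, of the cube complex with coefficients
in a cone functor. -/
noncomputable def cubeCone (m : Fin r) (n : ℤ) :
    (⨁ y : Level L n, (coneFunctor x A).obj y.1) →+
      ⨁ y : Level L (n + 1), (coneFunctor x A).obj y.1 :=
  coneLift (fun y : Level L n => y.1) fun y => ∑ w : Level L (n + 1),
    incidenceAt φ m w.1.1 y.1.1 • coneOf x A (fun y : Level L (n + 1) => y.1) w

theorem cubeCone_coneOf (m : Fin r) {n : ℤ} (y : Level L n) (a : A) (hy : x ≤ y.1) :
    cubeCone φ x A m n (coneOf x A (fun y : Level L n => y.1) y a) =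
      ∑ w : Level L (n + 1), incidenceAt φ m w.1.1 y.1.1 •
        coneOf x A (fun y : Level L (n + 1) => y.1) w a := by
  rw [cubeCone, coneLift_coneOf _ _ hy, AddMonoidHom.finsetSum_apply]
  rfl

theorem cubeCone_homotopy {m : Fin r} (hm : φ x.1 m = false) (n : ℕ) :
    (cubeBoundary φ (coneFunctor x A) ((n : ℤ) + 1)).comp (cubeCone φ x A m ((n : ℤ) + 1)) +
      (cubeCone φ x A m n).comp (cubeBoundary φ (coneFunctor x A) n) = AddMonoidHom.id _ := by
  classical
  refine coneSum_ext _ fun y hy a => ?_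
  have e1 : (cubeBoundary φ (coneFunctor x A) ((n : ℤ) + 1)) (cubeCone φ x A m ((n : ℤ) + 1)
        (coneOf x A (fun y : Level L ((n : ℤ) + 1) => y.1) y a)) =
      ∑ z : Level L ((n : ℤ) + 1), (∑ w : Level L ((n : ℤ) + 1 + 1),
        incidenceAt φ m w.1.1 y.1.1 * incidence φ w.1.1 z.1.1) •
          coneOf x A (fun y : Level L ((n : ℤ) + 1) => y.1) z a := by
    rw [cubeCone_coneOf m y a hy, map_sum]
    simp only [Finset.sum_smul]
    rw [Finset.sum_comm]
    refine Finset.sum_congr rfl fun w _ => ?_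
    rw [map_zsmul]
    -- The boundary formula needs `x ≤ w`, which is available exactly when the coefficient does not
    -- vanish.
    by_cases h : incidenceAt φ m w.1.1 y.1.1 = 0
    · simp [h]
    · rw [cubeBoundary_coneOf w a (le_of_incidenceAt_ne_zero hm h hy), Finset.smul_sum]
      simp only [mul_smul]
  have e2 : (cubeCone φ x A m n) (cubeBoundary φ (coneFunctor x A) n
        (coneOf x A (fun y : Level L ((n : ℤ) + 1) => y.1) y a)) =
      ∑ z : Level L ((n : ℤ) + 1), (∑ p : Level L n,
        incidence φ y.1.1 p.1.1 * incidenceAt φ m z.1.1 p.1.1) •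
          coneOf x A (fun y : Level L ((n : ℤ) + 1) => y.1) z a := by
    rw [cubeBoundary_coneOf y a hy, map_sum]
    simp only [Finset.sum_smul]
    rw [Finset.sum_comm]
    refine Finset.sum_congr rfl fun p _ => ?_
    rw [map_zsmul]
    by_cases h : incidence φ y.1.1 p.1.1 = 0
    · simp [h]
    · rw [cubeCone_coneOf m p a (hy.trans (covBy_of_incidence_ne_zero h).le), Finset.smul_sum]
      simp only [mul_smul]
  rw [AddMonoidHom.add_apply, AddMonoidHom.comp_apply, AddMonoidHom.comp_apply, e1, e2,
    ← Finset.sum_add_distrib, AddMonoidHom.id_apply, Finset.sum_eq_single y]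
  · rw [← add_smul, sum_incidence_mul_incidenceAt, if_pos rfl, one_smul]
  · intro z _ hz
    rw [← add_smul, sum_incidence_mul_incidenceAt, if_neg, zero_smul]
    exact fun h => hz (Subtype.ext (Subtype.ext h.symm))
  · simp

theorem cubeBoundary_cubeCone {m : Fin r} (hm : φ x.1 m = false) {n : ℕ}
    (z : ⨁ y : Level L ((n : ℤ) + 1), (coneFunctor x A).obj y.1)
    (hz : cubeBoundary φ (coneFunctor x A) n z = 0) :
    cubeBoundary φ (coneFunctor x A) ((n : ℤ) + 1) (cubeCone φ x A m ((n : ℤ) + 1) z) = z := by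
  have key := DFunLike.congr_fun (cubeCone_homotopy (A := A) hm n) z
  rwa [AddMonoidHom.add_apply, AddMonoidHom.comp_apply, AddMonoidHom.comp_apply, hz, map_zero,
    add_zero] at key

theorem cubeFunctor_coneFunctor_exactAt (φ : L ≃o (Fin r → Bool)) (x : {x : L // x ≠ ⊤})
    (A : AddCommGrpCat.{v}) (n : ℕ) :
    ((cubeFunctor φ).obj (coneFunctor x A)).ExactAt ((n : ℤ) + 1) := by
  obtain ⟨m, hm⟩ := exists_apply_eq_false φ x.2
  rw [HomologicalComplex.exactAt_iff' _ ((n : ℤ) + 1 + 1) ((n : ℤ) + 1) n (by simp) (by simp),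
    ShortComplex.ab_exact_iff]
  intro z hz
  change ((cubeComplex φ (coneFunctor x A)).d ((n : ℤ) + 1) n).hom z = 0 at hz
  rw [cubeComplex_d] at hz
  refine ⟨cubeCone φ x A m ((n : ℤ) + 1) z, ?_⟩
  change ((cubeComplex φ (coneFunctor x A)).d ((n : ℤ) + 1 + 1) ((n : ℤ) + 1)).hom _ = z
  rw [cubeComplex_d]
  exact cubeBoundary_cubeCone hm z hz

end CubeAcyclic

/-! ### Vertices and edges of the order complex -/

section Vertices

variable {X : Type u} [PartialOrder X] (F : X ⥤ AddCommGrpCat.{v}) {B : Type*} [AddCommGroup B]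

/-- The chain with the single element `x`. -/
def Chains.single (x : X) : Chains X 0 := ⟨fun _ => x, fun i j h => by omega⟩

/-- The chain `x < y`. -/
def Chains.pair {x y : X} (h : x < y) : Chains X 1 := (Chains.single y).cons h

open Classical in
/-- The inclusion of `F x` as the summand of the one-element chain `x`. -/
noncomputable def vertexOf (x : X) : F.obj x →+ ⨁ s : Chains X 0, F.obj s.min :=
  DirectSum.of (fun s : Chains X 0 => F.obj s.min) (Chains.single x)

open Classical in
theorem of_eq_vertexOf (s : Chains X 0) {x : X} (h : x ⟶ s.min) (a : F.obj x) :
    DirectSum.of (fun s : Chains X 0 => F.obj s.min) s ((F.map h).hom a) =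
      vertexOf F s.min ((F.map h).hom a) :=
  of_map_congr F Chains.min (t := Chains.single s.min)
    (Subtype.ext <| funext fun i => congrArg s.1 (by omega)) h h a

variable {F}

theorem map_id_apply (x : X) (h : x ⟶ x) (a : F.obj x) : (F.map h).hom a = a := by
  rw [Subsingleton.elim h (𝟙 x), F.map_id]
  rfl

theorem map_map_apply {x y z : X} (h : x ⟶ y) (k : y ⟶ z) (l : x ⟶ z) (a : F.obj x) :
    (F.map k).hom ((F.map h).hom a) = (F.map l).hom a := by
  rw [Subsingleton.elim l (h ≫ k), F.map_comp]
  rfl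

theorem vertex_ext {f g : (⨁ s : Chains X 0, F.obj s.min) →+ B}
    (h : ∀ x a, f (vertexOf F x a) = g (vertexOf F x a)) : f = g := by
  classical
  refine DirectSum.addHom_ext fun s a => ?_
  have e := of_eq_vertexOf F s (𝟙 _) a
  rw [map_id_apply] at e
  rw [e, h]

/-- The homomorphism given by `f x` on the summand of the one-element chain `x`. -/
noncomputable def vertexLift (f : ∀ x, F.obj x →+ B) :
    (⨁ s : Chains X 0, F.obj s.min) →+ B := by
  classical
  exact DirectSum.toAddMonoid fun s => f s.min

theorem vertexLift_vertexOf (f : ∀ x, F.obj x →+ B) (x : X) (a : F.obj x) :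
    vertexLift f (vertexOf F x a) = f x a := by
  classical
  exact DirectSum.toAddMonoid_of (fun s : Chains X 0 => f s.min) (Chains.single x) a

open Classical in
theorem chainBoundary_edge (s : Chains X 1) (a : F.obj s.min) :
    chainBoundary F 0 (DirectSum.of (fun s : Chains X 1 => F.obj s.min) s a) =
      vertexOf F (s.face 0).min ((F.map (homOfLE (s.min_le_min_face 0))).hom a) -
        vertexOf F s.min a := by
  rw [chainBoundary_of, Fin.sum_univ_two, of_eq_vertexOf, of_eq_vertexOf]
  have e : vertexOf F (s.face 1).min ((F.map (homOfLE (s.min_le_min_face 1))).hom a) =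
      vertexOf F s.min a := congrArg (vertexOf F s.min) (map_id_apply _ _ _)
  rw [e]
  simp [sub_eq_add_neg]

/-- The two vertices differ by the boundary of the edge `x < y`, which `p` kills. -/
theorem apply_vertexOf_of_le {p : (⨁ s : Chains X 0, F.obj s.min) →+ B}
    (hp : p.comp (chainBoundary F 0) = 0) {x y : X} (h : x ≤ y) (a : F.obj x) :
    p (vertexOf F y ((F.map (homOfLE h)).hom a)) = p (vertexOf F x a) := by
  classical
  rcases h.lt_or_eq with hlt | rfl
  · have e := DFunLike.congr_fun hp
      (DirectSum.of (fun s : Chains X 1 => F.obj s.min) (Chains.pair hlt) a)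
    rw [AddMonoidHom.comp_apply] at e
    have e' := (congrArg p (chainBoundary_edge (Chains.pair hlt) a)).symm.trans e
    rw [map_sub] at e'
    exact sub_eq_zero.1 e'
  · rw [map_id_apply]

end Vertices

/-! ### Comparison of the cokernels in degree zero -/

section DegreeZero

variable {L : Type u} [BooleanAlgebra L] {r : ℕ} (φ : L ≃o (Fin r → Bool))
  (F : {x : L // x ≠ ⊤} ⥤ AddCommGrpCat.{v}) {B : Type*} [AddCommGroup B]

open Classical in
/-- The comparison map in degree `0`, from the cube complex to the order complex. -/
noncomputable def cubeToOrder :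
    (⨁ y : Level L 0, F.obj y.1) →+ ⨁ s : Chains {x : L // x ≠ ⊤} 0, F.obj s.min :=
  DirectSum.toAddMonoid fun y => incidence φ y.1.1 ⊤ • vertexOf F y.1

open Classical in
theorem cubeToOrder_of (y : Level L 0) (a : F.obj y.1) :
    cubeToOrder φ F (DirectSum.of (fun y : Level L 0 => F.obj y.1) y a) =
      incidence φ y.1.1 ⊤ • vertexOf F y.1 a := by
  rw [cubeToOrder, DirectSum.toAddMonoid_of]
  rfl

theorem cubeToOrder_sumMap {F G : {x : L // x ≠ ⊤} ⥤ AddCommGrpCat.{v}} (f : F ⟶ G) :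
    (cubeToOrder φ G).comp (sumMap (fun y : Level L 0 => y.1) f) =
      (sumMap Chains.min f).comp (cubeToOrder φ F) := by
  classical
  refine DirectSum.addHom_ext fun y a => ?_
  rw [AddMonoidHom.comp_apply, AddMonoidHom.comp_apply, sumMap_of, cubeToOrder_of,
    cubeToOrder_of, map_zsmul]
  exact congrArg _ (sumMap_of Chains.min f (Chains.single y.1) a).symm

variable [Finite L]

theorem level_zero_covBy_top (φ : L ≃o (Fin r → Bool)) (y : Level L 0) : y.1.1 ⋖ ⊤ := by
  obtain ⟨m, hm⟩ := exists_apply_eq_false φ y.1.2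
  obtain ⟨z, hz, -, -⟩ := exists_covBy_of_apply_eq_false φ hm
  have h1 := rk_covBy φ hz
  have h2 := y.2
  obtain rfl : z = ⊤ := by
    by_contra h
    have := rk_lt_rk (lt_top_iff_ne_top.2 h)
    omega
  exact hz

/-- The coatom is `⊤` with one coordinate switched off, chosen among those that are `0` in `x`. -/
theorem exists_level_zero_ge (φ : L ≃o (Fin r → Bool)) (x : {x : L // x ≠ ⊤}) :
    ∃ y : Level L 0, x ≤ y.1 := by
  obtain ⟨m, hm⟩ := exists_apply_eq_false φ x.2
  obtain ⟨w, hw, -, e⟩ := exists_covBy_of_apply_eq_true φ (y := ⊤) (m := m)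
    (by rw [map_top]; rfl)
  have h1 := rk_covBy φ hw
  refine ⟨⟨⟨w, hw.lt.ne⟩, by dsimp only; omega⟩, (OrderIso.le_iff_le φ).1 fun j => ?_⟩
  dsimp only
  rw [e]
  by_cases hj : j = m
  · subst hj
    rw [hm]
    exact bot_le
  · rw [Function.update_of_ne hj, map_top]
    exact le_top

theorem incidence_top_mul_self (y : Level L 0) :
    incidence φ y.1.1 ⊤ * incidence φ y.1.1 ⊤ = 1 := by
  rw [incidence_of_covBy (level_zero_covBy_top φ y), coverSign_mul_self]

variable {F}

open Classical in
/-- The cube boundary of an element of corank two has exactly two terms. -/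
theorem cubeBoundary_zero_of {w : Level L (0 + 1)} {y z : Level L 0} (hy : w.1.1 ⋖ y.1.1)
    (hz : w.1.1 ⋖ z.1.1) (hne : y ≠ z) (a : F.obj w.1) :
    cubeBoundary φ F 0 (DirectSum.of (fun x : Level L (0 + 1) => F.obj x.1) w a) =
      coverSign φ hy • DirectSum.of (fun y : Level L 0 => F.obj y.1) y
          ((F.map (homOfLE (show w.1 ≤ y.1 from hy.le))).hom a) +
        coverSign φ hz • DirectSum.of (fun y : Level L 0 => F.obj y.1) z
          ((F.map (homOfLE (show w.1 ≤ z.1 from hz.le))).hom a) := by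
  rw [cubeBoundary_of, Finset.sum_eq_add (a := y) (b := z) hne, dif_pos hy, dif_pos hz]
  · rintro t - ⟨hty, htz⟩
    refine dif_neg fun ht => ?_
    obtain ⟨u, -, -, -, -, huniq⟩ := exists_diamond φ hy (level_zero_covBy_top φ y)
    have hz' := (huniq z.1.1 hz (level_zero_covBy_top φ z)).resolve_left
      fun h => hne (Subtype.ext (Subtype.ext h)).symm
    rcases huniq t.1.1 ht (level_zero_covBy_top φ t) with h | h
    · exact hty (Subtype.ext (Subtype.ext h))
    · exact htz (Subtype.ext (Subtype.ext (h.trans hz'.symm)))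
  · simp
  · simp

-- Independence of the coatom chosen above `x`. For coatoms `y ≠ z` above `x`, the meet `y ⊓ z` is
-- still above `x` and has corank two; its cube boundary, killed by `q`, relates the two values with
-- the required sign.
open Classical in
theorem apply_of_level_zero {q : (⨁ y : Level L 0, F.obj y.1) →+ B}
    (hq : q.comp (cubeBoundary φ F 0) = 0) {x : {x : L // x ≠ ⊤}} {y z : Level L 0}
    (hy : x ≤ y.1) (hz : x ≤ z.1) (a : F.obj x) :
    incidence φ y.1.1 ⊤ • q (DirectSum.of (fun y : Level L 0 => F.obj y.1) y
        ((F.map (homOfLE hy)).hom a)) =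
      incidence φ z.1.1 ⊤ • q (DirectSum.of (fun y : Level L 0 => F.obj y.1) z
        ((F.map (homOfLE hz)).hom a)) := by
  by_cases hne : y = z
  · subst hne
    rfl
  have hyt := level_zero_covBy_top φ y
  have hzt := level_zero_covBy_top φ z
  have hne' : y.1.1 ≠ z.1.1 := fun h => hne (Subtype.ext (Subtype.ext h))
  obtain ⟨w, hwy, -, hwz⟩ := exists_lower (φ := φ) hyt hzt rfl hne'
  obtain ⟨w, rfl⟩ := exists_level_succ_of_covBy φ y hwy
  have hxw : x ≤ w.1 := by
    change x.1 ≤ w.1.1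
    rw [← hwy.wcovBy.inf_eq hwz.wcovBy hne']
    exact le_inf hy hz
  have e := DFunLike.congr_fun hq (DirectSum.of (fun x : Level L (0 + 1) => F.obj x.1) w
    ((F.map (homOfLE hxw)).hom a))
  rw [AddMonoidHom.comp_apply, cubeBoundary_zero_of φ hwy hwz hne, map_map_apply _ _ (homOfLE hy),
    map_map_apply _ _ (homOfLE hz), map_add, map_zsmul, map_zsmul, AddMonoidHom.zero_apply] at e
  have hd := coverSign_diamond (φ := φ) hwy hwz hyt hzt hne'
  have h1 := coverSign_mul_self φ hwy
  have h2 := coverSign_mul_self φ hyt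
  rw [incidence_of_covBy hyt, incidence_of_covBy hzt]
  generalize q _ = b at e ⊢
  generalize q _ = c at e ⊢
  generalize coverSign φ hwy = s at *
  generalize coverSign φ hwz = t at *
  generalize coverSign φ hyt = s' at *
  generalize coverSign φ hzt = t' at *
  -- Both signs at the top are rewritten with the common factor `s' * s`, so that the difference of
  -- the two sides becomes a multiple of the relation `e`.
  have e1 : s' = (s' * s) * s := by linear_combination -s' * h1
  have e2 : t' = - ((s' * s) * t) := by linear_combination -t' * h2 + s' * hd
  rw [e2, neg_smul, mul_smul (s' * s) t, eq_neg_iff_add_eq_zero]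
  nth_rewrite 1 [e1]
  rw [mul_smul (s' * s) s, ← smul_add, e, smul_zero]

open Classical in
/-- The map out of the order complex in degree `0` determined by a map out of the cube complex. -/
noncomputable def orderLift (q : (⨁ y : Level L 0, F.obj y.1) →+ B) :
    (⨁ s : Chains {x : L // x ≠ ⊤} 0, F.obj s.min) →+ B :=
  vertexLift fun x =>
    incidence φ (exists_level_zero_ge φ x).choose.1.1 ⊤ •
      (q.comp (DirectSum.of (fun y : Level L 0 => F.obj y.1) (exists_level_zero_ge φ x).choose)).comp
        (F.map (homOfLE (exists_level_zero_ge φ x).choose_spec)).hom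

open Classical in
theorem orderLift_vertexOf {q : (⨁ y : Level L 0, F.obj y.1) →+ B}
    (hq : q.comp (cubeBoundary φ F 0) = 0) {x : {x : L // x ≠ ⊤}} {y : Level L 0}
    (hy : x ≤ y.1) (a : F.obj x) :
    orderLift φ q (vertexOf F x a) =
      incidence φ y.1.1 ⊤ • q (DirectSum.of (fun y : Level L 0 => F.obj y.1) y
        ((F.map (homOfLE hy)).hom a)) :=
  (vertexLift_vertexOf _ x a).trans (apply_of_level_zero φ hq _ hy a)

theorem orderLift_comp_chainBoundary {q : (⨁ y : Level L 0, F.obj y.1) →+ B}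
    (hq : q.comp (cubeBoundary φ F 0) = 0) : (orderLift φ q).comp (chainBoundary F 0) = 0 := by
  classical
  refine DirectSum.addHom_ext fun s a => ?_
  obtain ⟨y, hy⟩ := exists_level_zero_ge φ (s.face 0).min
  rw [AddMonoidHom.comp_apply, chainBoundary_edge, map_sub, orderLift_vertexOf φ hq hy,
    orderLift_vertexOf φ hq ((s.min_le_min_face 0).trans hy),
    map_map_apply _ _ (homOfLE ((s.min_le_min_face 0).trans hy)), sub_self]
  rfl

theorem orderLift_comp_cubeToOrder {q : (⨁ y : Level L 0, F.obj y.1) →+ B}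
    (hq : q.comp (cubeBoundary φ F 0) = 0) : (orderLift φ q).comp (cubeToOrder φ F) = q := by
  classical
  refine DirectSum.addHom_ext fun y a => ?_
  rw [AddMonoidHom.comp_apply, cubeToOrder_of, map_zsmul, orderLift_vertexOf φ hq le_rfl,
    smul_smul, incidence_top_mul_self, one_smul, map_id_apply]

/-- An element `w` of corank two has two upper covers, both coatoms. Modulo edges both images equal
the vertex `w`, with coefficients `ε(w ⋖ y) ε(y ⋖ ⊤)` that cancel; hence the sign `ε(y ⋖ ⊤)` in
`cubeToOrder`. -/
theorem comp_cubeToOrder_comp_cubeBoundary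
    {p : (⨁ s : Chains {x : L // x ≠ ⊤} 0, F.obj s.min) →+ B}
    (hp : p.comp (chainBoundary F 0) = 0) :
    (p.comp (cubeToOrder φ F)).comp (cubeBoundary φ F 0) = 0 := by
  classical
  refine DirectSum.addHom_ext fun w a => ?_
  have hw := w.2
  obtain ⟨m, hm⟩ := exists_apply_eq_false φ w.1.2
  obtain ⟨y, hy, -, -⟩ := exists_covBy_of_apply_eq_false φ hm
  obtain ⟨y, rfl⟩ := exists_level_of_covBy (n := 0) φ w hy
  obtain ⟨z, hwz, -, hne, -, -⟩ := exists_diamond φ hy (level_zero_covBy_top φ y)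
  obtain ⟨z, rfl⟩ := exists_level_of_covBy (n := 0) φ w hwz
  have hne' : y ≠ z := fun h => hne (congrArg (fun t : Level L 0 => t.1.1) h).symm
  rw [AddMonoidHom.comp_apply, AddMonoidHom.comp_apply, cubeBoundary_zero_of φ hy hwz hne',
    map_add, map_zsmul, map_zsmul, cubeToOrder_of, cubeToOrder_of, map_add, map_zsmul, map_zsmul,
    map_zsmul, map_zsmul, apply_vertexOf_of_le hp, apply_vertexOf_of_le hp, smul_smul, smul_smul,
    ← add_smul, incidence_of_covBy (level_zero_covBy_top φ y),
    incidence_of_covBy (level_zero_covBy_top φ z)]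
  obtain ⟨t, k, k', -, h, huniq⟩ := exists_diamond φ hy (level_zero_covBy_top φ y)
  obtain rfl : z.1.1 = t := (huniq z.1.1 hwz (level_zero_covBy_top φ z)).resolve_left hne
  rw [h, zero_smul]
  rfl

/-- A map killing edges is determined by its values on coatoms, since each vertex can be pushed up
to one. -/
theorem orderLift_comp_cubeToOrder_right
    {p : (⨁ s : Chains {x : L // x ≠ ⊤} 0, F.obj s.min) →+ B}
    (hp : p.comp (chainBoundary F 0) = 0) :
    orderLift φ (p.comp (cubeToOrder φ F)) = p := by
  classical
  refine vertex_ext fun x a => ?_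
  obtain ⟨y, hy⟩ := exists_level_zero_ge φ x
  rw [orderLift_vertexOf φ (comp_cubeToOrder_comp_cubeBoundary φ hp) hy, AddMonoidHom.comp_apply,
    cubeToOrder_of, map_zsmul, smul_smul, incidence_top_mul_self, one_smul,
    apply_vertexOf_of_le hp]

end DegreeZero

/-! ### Dimension shifting -/

section DimensionShift

universe w₁ w₂ w₃ w₄

variable {C : Type w₁} [Category.{w₂} C] [Abelian C] {D : Type w₃} [Category.{w₄} D] [Abelian D]
  {ι : Type*} {c : ComplexShape ι} (T : C ⥤ HomologicalComplex D c)

/-- For a homological functor and a short exact sequence with middle term acyclic in degree `i`, the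
homology of the third term in degree `i` is the kernel of the map between the homologies of the
first two terms in the next degree. -/
noncomputable def homologyIsoKernel [T.PreservesZeroMorphisms] {S : ShortComplex C}
    (hS : (S.map T).ShortExact) {i j : ι} (hij : c.Rel i j)
    (h : (T.obj S.X₂).ExactAt i) :
    (T.obj S.X₃).homology i ≅
      Limits.kernel ((T ⋙ HomologicalComplex.homologyFunctor D c j).map S.f) := by
  have := hS.mono_δ i j hij h.isZero_homology
  exact (hS.homology_exact₁ i j hij).fIsKernel.conePointUniqueUpToIso
    (Limits.limit.isLimit _)

/-- If moreover the middle term is acyclic in the next degree, then the homology of the third term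
is the homology of the first one in the next degree. -/
noncomputable def homologyIsoShift [T.PreservesZeroMorphisms] {S : ShortComplex C}
    (hS : (S.map T).ShortExact) {i j : ι} (hij : c.Rel i j)
    (hi : (T.obj S.X₂).ExactAt i) (hj : (T.obj S.X₂).ExactAt j) :
    (T.obj S.X₃).homology i ≅ (T.obj S.X₁).homology j :=
  hS.δIso i j hij hi.isZero_homology hj.isZero_homology

/-- Homology is additive, so the identity on the homology of the biproduct is a sum of maps
factoring through the zero objects `H(f j)`. -/
theorem exactAt_biproduct [T.Additive] [Limits.HasFiniteBiproducts C] {J : Type*} [Finite J]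
    (f : J → C) (i : ι) (h : ∀ j, (T.obj (f j)).ExactAt i) :
    (T.obj (Limits.biproduct f)).ExactAt i := by
  cases nonempty_fintype J
  let G := T ⋙ HomologicalComplex.homologyFunctor D c i
  rw [HomologicalComplex.exactAt_iff_isZero_homology, Limits.IsZero.iff_id_eq_zero]
  change 𝟙 (G.obj (Limits.biproduct f)) = 0
  have e : ∑ j, Limits.biproduct.π f j ≫ Limits.biproduct.ι f j = 𝟙 (Limits.biproduct f) := by
    classical
    ext j
    simp [Preadditive.sum_comp, Limits.biproduct.ι_π, comp_dite]
  replace e := congrArg G.map e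
  rw [G.map_id, G.map_sum] at e
  rw [← e]
  refine Finset.sum_eq_zero fun j _ => ?_
  rw [G.map_comp]
  have hj : Limits.IsZero (G.obj (f j)) := (h j).isZero_homology
  rw [hj.eq_of_tgt (G.map (Limits.biproduct.π f j)) 0, Limits.zero_comp]

end DimensionShift

/-- A cube whose other five faces commute has a commuting sixth face, since the epimorphism `p` can
be cancelled. It transfers naturality from chains to opcycles. -/
theorem comp_eq_comp_of_epi {D : Type*} [Category* D] {A A' B B' K K' Q Q' : D} {p : A ⟶ B}
    {p' : A' ⟶ B'} {q : K ⟶ Q} {q' : K' ⟶ Q'} {a : A ⟶ A'} {b : B ⟶ B'} {k : K ⟶ K'} {l : Q ⟶ Q'}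
    {s : A ⟶ K} {s' : A' ⟶ K'} {t : B ⟶ Q} {t' : B' ⟶ Q'} [Epi p] (h₁ : p ≫ b = a ≫ p')
    (h₂ : q ≫ l = k ≫ q') (h₃ : a ≫ s' = s ≫ k) (h₄ : p ≫ t = s ≫ q) (h₅ : p' ≫ t' = s' ≫ q') :
    b ≫ t' = t ≫ l := by
  rw [← cancel_epi p, reassoc_of% h₁, h₅, reassoc_of% h₃, reassoc_of% h₄, h₂]

/-! ### The comparison isomorphism and the induction on the degree -/

section Comparison

variable {L : Type u} [BooleanAlgebra L] [Finite L] {r : ℕ} (φ : L ≃o (Fin r → Bool))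

theorem isZero_cubeComplex_X_of_neg (F : {x : L // x ≠ ⊤} ⥤ AddCommGrpCat.{v}) {n : ℤ}
    (hn : n < 0) : Limits.IsZero ((cubeComplex φ F).X n) := by
  have : IsEmpty (Level L n) := ⟨fun x => by
    have h1 := rk_lt_rk (lt_top_iff_ne_top.2 x.1.2)
    have h2 := x.2
    omega⟩
  have : Subsingleton (⨁ x : Level L n, F.obj x.1) :=
    ⟨fun a b => DFinsupp.ext fun i => isEmptyElim i⟩
  exact AddCommGrpCat.isZero_of_subsingleton (AddCommGrpCat.of (⨁ x : Level L n, F.obj x.1))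

variable (F : {x : L // x ≠ ⊤} ⥤ AddCommGrpCat.{v})

/-- The comparison map in degree `0`, as a morphism between the terms of the complexes. -/
noncomputable def comparison : (cubeComplex φ F).X 0 ⟶ (orderComplexNat F).X 0 :=
  AddCommGrpCat.ofHom (cubeToOrder φ F)

variable {F} {A : AddCommGrpCat.{max u v}}

theorem cubeBoundary_hom_comp {k : (cubeComplex φ F).X 0 ⟶ A}
    (hk : (cubeComplex φ F).d (0 + 1) 0 ≫ k = 0) : k.hom.comp (cubeBoundary φ F 0) = 0 := by
  rw [cubeComplex_d] at hk
  exact congrArg AddCommGrpCat.Hom.hom hk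

theorem chainBoundary_hom_comp {X : Type u} [PartialOrder X] {F : X ⥤ AddCommGrpCat.{v}}
    {k : (orderComplexNat F).X 0 ⟶ A}
    (hk : (orderComplexNat F).d (0 + 1) 0 ≫ k = 0) : k.hom.comp (chainBoundary F 0) = 0 := by
  rw [orderComplexNat_d] at hk
  exact congrArg AddCommGrpCat.Hom.hom hk

theorem d_comparison {p : (orderComplexNat F).X 0 ⟶ A}
    (hp : (orderComplexNat F).d (0 + 1) 0 ≫ p = 0) :
    (cubeComplex φ F).d (0 + 1) 0 ≫ comparison φ F ≫ p = 0 := by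
  rw [cubeComplex_d]
  exact AddCommGrpCat.hom_ext
    (comp_cubeToOrder_comp_cubeBoundary φ (chainBoundary_hom_comp hp))

theorem exists_comparison_comp {q : (cubeComplex φ F).X 0 ⟶ A}
    (hq : (cubeComplex φ F).d (0 + 1) 0 ≫ q = 0) :
    ∃ p : (orderComplexNat F).X 0 ⟶ A,
      (orderComplexNat F).d (0 + 1) 0 ≫ p = 0 ∧ comparison φ F ≫ p = q := by
  refine ⟨AddCommGrpCat.ofHom (orderLift φ q.hom), ?_, ?_⟩
  · rw [orderComplexNat_d]
    exact AddCommGrpCat.hom_ext (orderLift_comp_chainBoundary φ (cubeBoundary_hom_comp φ hq))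
  · exact AddCommGrpCat.hom_ext (orderLift_comp_cubeToOrder φ (cubeBoundary_hom_comp φ hq))

theorem eq_of_comparison_comp_eq {p p' : (orderComplexNat F).X 0 ⟶ A}
    (hp : (orderComplexNat F).d (0 + 1) 0 ≫ p = 0)
    (hp' : (orderComplexNat F).d (0 + 1) 0 ≫ p' = 0)
    (h : comparison φ F ≫ p = comparison φ F ≫ p') : p = p' := by
  have e := orderLift_comp_cubeToOrder_right φ (chainBoundary_hom_comp hp)
  have e' := orderLift_comp_cubeToOrder_right φ (chainBoundary_hom_comp hp')
  have h' : p.hom.comp (cubeToOrder φ F) = p'.hom.comp (cubeToOrder φ F) :=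
    congrArg AddCommGrpCat.Hom.hom h
  exact AddCommGrpCat.hom_ext (e.symm.trans ((congrArg (orderLift φ) h').trans e'))

variable (F)

/-- The map induced on opcycles by the comparison map. -/
noncomputable def opcyclesComparison :
    (cubeComplex φ F).opcycles 0 ⟶ (orderComplexNat F).opcycles 0 :=
  (cubeComplex φ F).descOpcycles (comparison φ F ≫ (orderComplexNat F).pOpcycles 0) (0 + 1)
    (by simp) (d_comparison φ ((orderComplexNat F).d_pOpcycles _ _))

theorem pOpcycles_opcyclesComparison :
    (cubeComplex φ F).pOpcycles 0 ≫ opcyclesComparison φ F =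
      comparison φ F ≫ (orderComplexNat F).pOpcycles 0 :=
  HomologicalComplex.p_descOpcycles _ _ _ _ _

/-- A Yoneda argument: opcycles corepresent maps killing the incoming differential, and
precomposition with `comparison` is a bijection between such maps. The inverse is the lift of the
cube projection `pOpcycles`. -/
instance : IsIso (opcyclesComparison φ F) := by
  obtain ⟨p, hp, e⟩ := exists_comparison_comp φ ((cubeComplex φ F).d_pOpcycles (0 + 1) 0)
  refine ⟨(orderComplexNat F).descOpcycles p (0 + 1) (by simp) hp, ?_, ?_⟩
  · rw [← cancel_epi ((cubeComplex φ F).pOpcycles 0), ← Category.assoc,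
      pOpcycles_opcyclesComparison, Category.assoc, HomologicalComplex.p_descOpcycles, e,
      Category.comp_id]
  · rw [← cancel_epi ((orderComplexNat F).pOpcycles 0), ← Category.assoc,
      HomologicalComplex.p_descOpcycles, Category.comp_id]
    refine eq_of_comparison_comp_eq φ ?_ ((orderComplexNat F).d_pOpcycles _ _) ?_
    · rw [← Category.assoc, hp, Limits.zero_comp]
    · rw [← Category.assoc, e, pOpcycles_opcyclesComparison]

variable {F}

theorem opcyclesComparison_naturality {G : {x : L // x ≠ ⊤} ⥤ AddCommGrpCat.{v}} (f : F ⟶ G) :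
    HomologicalComplex.opcyclesMap ((cubeFunctor φ).map f) 0 ≫ opcyclesComparison φ G =
      opcyclesComparison φ F ≫ HomologicalComplex.opcyclesMap ((orderFunctor _).map f) 0 := by
  have h : ((cubeFunctor φ).map f).f 0 ≫ comparison φ G =
      comparison φ F ≫ ((orderFunctor _).map f).f 0 :=
    AddCommGrpCat.hom_ext (cubeToOrder_sumMap φ f)
  have : Epi ((cubeComplex φ F).pOpcycles 0) := inferInstance
  have e1 := HomologicalComplex.p_opcyclesMap ((cubeFunctor φ).map f) 0
  have e2 := HomologicalComplex.p_opcyclesMap ((orderFunctor _).map f) 0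
  exact comp_eq_comp_of_epi e1 e2 h (pOpcycles_opcyclesComparison φ F)
    (pOpcycles_opcyclesComparison φ G)

/-- The cube complex and the order complex have naturally isomorphic homology in degree `0`. -/
noncomputable def homologyZeroIso :
    cubeFunctor.{u, v} φ ⋙ HomologicalComplex.homologyFunctor _ _ 0 ≅
      orderFunctor {x : L // x ≠ ⊤} ⋙ HomologicalComplex.homologyFunctor _ _ 0 :=
  NatIso.ofComponents
    -- Homology equals opcycles in degree `0`, as the outgoing differential vanishes: the cube
    -- complex is zero in degree `-1`, and the order complex indexed by `ℕ` has no lower degree.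
    (fun F => (cubeComplex φ F).isoHomologyι 0 (-1) (by simp)
        ((isZero_cubeComplex_X_of_neg φ F (by norm_num)).eq_of_tgt _ _) ≪≫
      asIso (opcyclesComparison φ F) ≪≫
      ((orderComplexNat F).isoHomologyι 0 0 (by simp) (by simp)).symm) fun {F G} f => by
    have h1 : CommSq ((cubeComplex φ F).homologyι 0)
        (HomologicalComplex.homologyMap ((cubeFunctor φ).map f) 0)
        (HomologicalComplex.opcyclesMap ((cubeFunctor φ).map f) 0)
        ((cubeComplex φ G).homologyι 0) :=
      ⟨(HomologicalComplex.homologyι_naturality ((cubeFunctor φ).map f) 0).symm⟩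
    have h2 : CommSq (opcyclesComparison φ F)
        (HomologicalComplex.opcyclesMap ((cubeFunctor φ).map f) 0)
        (HomologicalComplex.opcyclesMap ((orderFunctor _).map f) 0)
        (opcyclesComparison φ G) := ⟨(opcyclesComparison_naturality φ f).symm⟩
    have h3 : CommSq ((orderComplexNat F).isoHomologyι 0 0 (by simp) (by simp)).hom
        (HomologicalComplex.homologyMap ((orderFunctor _).map f) 0)
        (HomologicalComplex.opcyclesMap ((orderFunctor _).map f) 0)
        ((orderComplexNat G).isoHomologyι 0 0 (by simp) (by simp)).hom :=
      ⟨(HomologicalComplex.homologyι_naturality ((orderFunctor _).map f) 0).symm⟩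
    exact (h1.horiz_comp (h2.horiz_comp h3.horiz_inv)).w.symm

theorem nonempty_homology_iso (n : ℕ) (F : {x : L // x ≠ ⊤} ⥤ AddCommGrpCat.{v}) :
    Nonempty ((orderComplexNat F).homology n ≅ (cubeComplex φ F).homology n) := by
  induction n generalizing F with
  | zero => exact ⟨((homologyZeroIso φ).app F).symm⟩
  | succ n ih =>
    let P := Limits.biproduct fun x => coneFunctor x (F.obj x)
    let π : P ⟶ F := Limits.biproduct.desc (coneDesc F)
    have : Epi π := epi_biproduct_desc_coneDesc F
    let S : ShortComplex ({x : L // x ≠ ⊤} ⥤ AddCommGrpCat.{v}) :=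
      ShortComplex.mk (Limits.kernel.ι π) π (Limits.kernel.condition π)
    have hS : S.ShortExact :=
      { exact := ShortComplex.exact_kernel π, mono_f := inferInstance, epi_g := this }
    have hT := orderFunctor_shortExact hS
    have hT' := cubeFunctor_shortExact φ hS
    have hP (k : ℕ) : ((orderFunctor _).obj P).ExactAt (k + 1) :=
      exactAt_biproduct _ _ _ fun x => orderFunctor_coneFunctor_exactAt x _ k
    have hP' (k : ℕ) : ((cubeFunctor φ).obj P).ExactAt ((k : ℤ) + 1) :=
      exactAt_biproduct _ _ _ fun x => cubeFunctor_coneFunctor_exactAt φ x _ k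
    -- `P` need not be acyclic in degree `0`, so `H₁` is only a kernel of a map between `H₀`s, and
    -- here the naturality of `homologyZeroIso` is needed. Above that the connecting map is an
    -- isomorphism, and a mere isomorphism for the kernel of `π` suffices.
    cases n with
    | zero =>
      refine ⟨homologyIsoKernel (orderFunctor _) hT (i := 1) (j := 0) (by simp) (hP 0) ≪≫ ?_ ≪≫
        (homologyIsoKernel (cubeFunctor φ) hT' (i := 1) (j := 0) (by simp) (hP' 0)).symm⟩
      exact Limits.kernel.mapIso _ _ ((homologyZeroIso φ).app _).symm
        ((homologyZeroIso φ).app _).symm ((homologyZeroIso φ).inv.naturality S.f)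
    | succ n =>
      obtain ⟨e⟩ := ih (Limits.kernel π)
      exact ⟨homologyIsoShift (orderFunctor _) hT (i := n + 1 + 1) (j := n + 1) (by simp)
          (hP _) (hP _) ≪≫ e ≪≫
        (homologyIsoShift (cubeFunctor φ) hT' (i := ((n + 1 + 1 : ℕ) : ℤ)) (j := ((n + 1 : ℕ) : ℤ))
          (by simp) (hP' _) (hP' _)).symm⟩

end Comparison

end PosetHomology

theorem mainTheorem3 (L : Type u) [BooleanAlgebra L] [Finite L]
    (φ : L ≃o (Fin (PosetHomology.rk (⊤ : L)) → Bool))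
    (F : {x : L // x ≠ ⊤} ⥤ AddCommGrpCat.{v}) (n : ℤ) :
    Nonempty ((PosetHomology.orderComplex F).homology n ≅
      (PosetHomology.cubeComplex φ F).homology n) := by
  -- In negative degrees the order complex is extended by zero, and `Dₙ` is empty because no element
  -- other than `⊤` has rank at least that of `⊤`.
  rcases lt_or_ge n 0 with hn | hn
  · have h1 : Limits.IsZero ((PosetHomology.orderComplex F).homology n) :=
      ((PosetHomology.orderComplexNat F).extend_exactAt PosetHomology.embeddingNatInt n
        fun j hj => by
          change (j : ℤ) = n at hj
          omega).isZero_homology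
    have h2 : Limits.IsZero ((PosetHomology.cubeComplex φ F).homology n) :=
      (HomologicalComplex.ExactAt.of_isZero
        (PosetHomology.isZero_cubeComplex_X_of_neg φ F hn)).isZero_homology
    exact ⟨h1.iso h2⟩
  · lift n to ℕ using hn
    obtain ⟨e⟩ := PosetHomology.nonempty_homology_iso φ n F
    exact ⟨(PosetHomology.orderComplexNat F).extendHomologyIso PosetHomology.embeddingNatInt
      (j := n) rfl ≪≫ e⟩
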